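/- Let $\mathbb H^3_1=\{(z^1,z^2)\in\mathbb C^2 : |z^1|^2-|z^2|^2=1\}$, identified with $SU(1,1)$ by $(z^1,z^2)\mapsto\begin{pmatrix} z^1&z^2\\ \bar z^2&\bar z^1\end{pmatrix}$, with base point $o=(1,0)$. Let $X_0,X_1,X_2$ be the left-invariant vector fields given by $$X_0=\begin{pmatrix} i&0\\0&-i\end{pmatrix},\quad X_1=\begin{pmatrix}0&1\\1&0\end{pmatrix},\quad X_2=\begin{pmatrix}0&i\\-i&0\end{pmatrix},$$ and $\theta^0,\theta^1,\theta^2$ the dual coframe. For real $\lambda<0$ and $\mu,\nu$ with $-\lambda=\mu=\nu$, and $t\in\mathbb R$, put $$g=\lambda\,\theta^0\otimes\theta^0+\mu\,\theta^1\otimes\theta^1+\nu\,\theta^2\otimes\theta^2,$$ $$S_\lambda(t)=-\lambda\,\theta^2\otimes(\theta^0\wedge\theta^1)+t\,\theta^0\otimes(\theta^1\wedge\theta^2)-\lambda\,\theta^1\otimes(\theta^2\wedge\theta^0),$$ where $\alpha\wedge\beta=\alpha\otimes\beta-\beta\otimes\alpha$, regarded as a $(1,2)$-tensor by $g(S_XY,Z)=S(X,Y,Z)$,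 and $$\phi_0=\bar X_1\otimes\bar\theta^2-\bar X_2\otimes\bar\theta^1,\quad \xi_0=\bar X_0,\quad \eta_0=\bar\theta^0,$$ where $\bar X_0=X_0/\sqrt{|\lambda|}$, $\bar X_1=X_1/\sqrt\mu$, $\bar X_2=X_2/\sqrt\nu$ and $\bar\theta^i$ is the dual coframe of $\bar X_i$. Let $\nabla$ be the Levi-Civita connection of $g$ and $\widetilde\nabla=\nabla-S_\lambda(t)$, with curvature $\widetilde R$. A connection of the form $\nabla-S$ is called induced by a transitive isometric action of a Lie group $G$ with isotropy group $H$ at $o$ and a reductive decomposition $\mathfrak g=\mathfrak m\oplus\mathfrak h$ ($\mathfrak h=\mathrm{Lie}(H)$, $\mathrm{Ad}(H)\mathfrak m\subset\mathfrak m$) if it is $G$-invariant and $(\nabla-S)_{X^*}Y^*|_o=-[X,Y]_{\mathfrak m}^*|_o$ for $X,Y\in\mathfrak m$, where $X^*$ is the vector field generated by $\exp(sX)$. The pair $(\mathfrak g,\mathfrak m\oplus\mathfrak h)$ is called induced by $S$ if, under $\mathfrak m\ni X\mapsto X^*|_o\in T_o\mathbb H^3_1$ and a linear isomorphism of $\mathfrak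 h$ onto the holonomy algebra $\widetilde{\mathfrak h}$ generated by the endomorphisms $\widetilde R(x,y)$ of $T_o\mathbb H^3_1$, the bracket of $\mathfrak g$ becomes $[U,V]=UV-VU$, $[U,x]=U(x)$, $[x,y]=S_xy-S_yx-\widetilde R(x,y)$ on $\widetilde{\mathfrak h}\oplus T_o\mathbb H^3_1$. Then $g$ is a Lorentzian metric with a unique Levi-Civita connection; $(g,\phi_0,\xi_0,\eta_0)$ is an almost contact metric structure which is $\frac1{\sqrt{-\lambda}}$-Sasakian, i.e. $(\nabla_X\phi_0)Y=\frac1{\sqrt{-\lambda}}\big(g(X,Y)\xi_0-\epsilon\,\eta_0(Y)X\big)$ with $\epsilon=g(\xi_0,\xi_0)=-1$; and $(S_\lambda(t),\phi_0,\xi_0,\eta_0)$ is a homogeneous almost contact metric structure, i.e. $g$, the curvature tensor $R$ of $\nabla$, $S_\lambda(t)$, $\phi_0$, $\xi_0$ and $\eta_0$ are all $\widetilde\nabla$-parallel. Moreover: 1. If $t\neq-\lambda$, the group $SU(1,1)\times U(1)$ acts on $(\mathbb H^3_1,g)$ by isometries, transitively and almost effectively (the elements acting trivially form a discrete subgroup),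 via $$(A,e^{is})\cdot Z=A\,Z\begin{pmatrix}e^{-is}&0\\0&e^{is}\end{pmatrix}.$$ Through the surjective homomorphism $(A,e^{is})\mapsto e^{-is}A$ this action factors through a transitive and effective isometric action of $U(1,1)$, which preserves $S_\lambda(t),\phi_0,\xi_0,\eta_0$. For this action $\mathfrak u(1,1)=\mathfrak m\oplus\mathfrak h$ with $$\mathfrak h=\mathrm{span}_{\mathbb R}\left\{\begin{pmatrix}0&0\\0&i\end{pmatrix}\right\},\qquad \mathfrak m=\mathrm{span}_{\mathbb R}\left\{\begin{pmatrix}i&0\\0&-i\frac{t}{-\lambda}\end{pmatrix},\begin{pmatrix}0&1\\1&0\end{pmatrix},\begin{pmatrix}0&i\\-i&0\end{pmatrix}\right\}$$ is a reductive decomposition, $\mathfrak h$ being the Lie algebra of the isotropy group at $o$; it induces the connection $\nabla-S_\lambda(t)$ and is induced by $S_\lambda(t)$. 2. If $t=-\lambda$, the group $SU(1,1)$ acts on $(\mathbb H^3_1,g)$ by left multiplication, transitively, effectively, by isometries, and preserving $S_\lambda(t),\phi_0,\xi_0,\eta_0$; the trivial decomposition $\mathfrak m=\mathfrak{su}(1,1)$,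 $\mathfrak h=\{0\}$ is a reductive decomposition which induces $\nabla-S_\lambda(t)$ and is induced by $S_\lambda(t)$. -/

import Mathlib

open scoped ContDiff ComplexConjugate

noncomputable section

namespace AdS

/-! ### The hypersurface `H = {(z₁, z₂) ∈ ℂ² : |z₁|² - |z₂|² = 1}` -/

/-- The ambient real vector space `ℂ² = ℝ^{2,2}`. -/
abbrev Amb : Type := ℂ × ℂ

/-- The quadratic form `|z₁|² - |z₂|²`. -/
def quad (w : Amb) : ℝ := Complex.normSq w.1 - Complex.normSq w.2

/-- The three-dimensional anti-de Sitter space as a hypersurface of `ℂ²`. -/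
@[ext]
structure H31 where
  val : Amb
  quad_val : quad val = 1

/-- The base point `(1, 0)`. -/
def base : H31 := ⟨(1, 0), by simp [quad]⟩

/-- The open cone `|z₁|² > |z₂|²`, an open neighbourhood of the hypersurface. -/
def cone : Set Amb := {w | 0 < quad w}

theorem quad_smul (c : ℝ) (w : Amb) : quad (c • w) = c ^ 2 * quad w := by
  simp [quad, Complex.normSq_apply]; ring

theorem val_mem_cone (p : H31) : p.val ∈ cone := by
  have h : quad p.val = 1 := p.quad_val
  simp [cone, h]

open Classical in
/-- The smooth radial retraction `w ↦ w / √(|w₁|² - |w₂|²)` of the cone onto the hypersurface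
(constant off the cone). -/
def retr (w : Amb) : H31 :=
  if h : 0 < quad w then
    ⟨(Real.sqrt (quad w))⁻¹ • w, by
      rw [quad_smul, inv_pow, Real.sq_sqrt h.le, inv_mul_cancel₀ h.ne']⟩
  else base

theorem retr_val (w : Amb) (h : w ∈ cone) : (retr w).val = (Real.sqrt (quad w))⁻¹ • w := by
  have h' : 0 < quad w := h
  unfold retr
  rw [dif_pos h']

theorem retr_of_val (p : H31) : retr p.val = p := by
  apply H31.ext
  have h : quad p.val = 1 := p.quad_val
  have h2 := retr_val p.val (val_mem_cone p)
  rw [h, Real.sqrt_one, inv_one, one_smul] at h2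
  exact h2

/-- Smoothness of a vector-valued function on the hypersurface. -/
def IsSmooth {E : Type*} [NormedAddCommGroup E] [NormedSpace ℝ E] (f : H31 → E) : Prop :=
  ContDiffOn ℝ ∞ (fun w => f (retr w)) cone

/-- The differential of a vector-valued function on the hypersurface at `p`,
applied to a tangent vector `v`. -/
def dirDeriv {E : Type*} [NormedAddCommGroup E] [NormedSpace ℝ E] (f : H31 → E) (p : H31)
    (v : Amb) : E :=
  fderiv ℝ (fun w => f (retr w)) p.val v

/-- The symmetric bilinear form of signature `(2,2)` polarizing `quad`. -/
def bil (v w : Amb) : ℝ := (conj v.1 * w.1).re - (conj v.2 * w.2).re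

theorem bil_eq (v w : Amb) : bil v w
    = v.1.re * w.1.re + v.1.im * w.1.im - (v.2.re * w.2.re + v.2.im * w.2.im) := by
  simp [bil]

/-- The tangent space of the hypersurface at `p`, as a subspace of `ℂ²`. -/
def TSpace (p : H31) : Submodule ℝ Amb where
  carrier := {v | bil p.val v = 0}
  add_mem' := by
    intro a b ha hb
    change bil p.val (a + b) = 0
    change bil p.val a = 0 at ha
    change bil p.val b = 0 at hb
    rw [bil_eq] at *
    simp only [Prod.fst_add, Prod.snd_add, Complex.add_re, Complex.add_im]
    linear_combination ha + hb
  zero_mem' := by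
    change bil p.val 0 = 0
    simp [bil]
  smul_mem' := by
    intro c a ha
    change bil p.val (c • a) = 0
    change bil p.val a = 0 at ha
    rw [bil_eq] at *
    simp only [Prod.smul_fst, Prod.smul_snd, Complex.smul_re, Complex.smul_im, smul_eq_mul]
    linear_combination c * ha

/-! ### Smooth functions and smooth vector fields -/

/-- The algebra of smooth real functions on the hypersurface, as a subalgebra. -/
def smoothFn : Subalgebra ℝ (H31 → ℝ) where
  carrier := {f | IsSmooth f}
  mul_mem' := fun ha hb => ContDiffOn.mul ha hb
  add_mem' := fun ha hb => ContDiffOn.add ha hb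
  algebraMap_mem' := fun _ => contDiffOn_const

/-- The module of smooth tangent vector fields on the hypersurface, as a submodule. -/
def vectorFields : Submodule smoothFn (H31 → Amb) where
  carrier := {X | IsSmooth X ∧ ∀ p, X p ∈ TSpace p}
  add_mem' := fun ha hb =>
    ⟨ContDiffOn.add ha.1 hb.1, fun p => (TSpace p).add_mem (ha.2 p) (hb.2 p)⟩
  zero_mem' := ⟨contDiffOn_const, fun p => (TSpace p).zero_mem⟩
  smul_mem' := fun c _ ha =>
    ⟨ContDiffOn.smul c.2 ha.1, fun p => (TSpace p).smul_mem (c.1 p) (ha.2 p)⟩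

/-- The algebra of smooth real functions on the hypersurface. -/
def Fn : Type := smoothFn

/-- The module of smooth tangent vector fields on the hypersurface. -/
def VF : Type := vectorFields

instance instCommRingFn : CommRing Fn := inferInstanceAs (CommRing smoothFn)

instance instAlgebraFn : Algebra ℝ Fn := inferInstanceAs (Algebra ℝ smoothFn)

instance instAddCommGroupVF : AddCommGroup VF := inferInstanceAs (AddCommGroup vectorFields)

instance instModuleVF : Module Fn VF := inferInstanceAs (Module smoothFn vectorFields)

theorem Fn.one_apply (p : H31) : (1 : Fn).1 p = 1 := rfl

theorem Fn.zero_apply (p : H31) : (0 : Fn).1 p = 0 := rfl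

/-- The value of a vector field at a point. -/
def VF.at (X : VF) (p : H31) : TSpace p := ⟨X.1 p, X.2.2 p⟩

theorem contDiff_quad : ContDiff ℝ ∞ quad := by
  have : quad = fun w : Amb => (w.1.re * w.1.re + w.1.im * w.1.im)
      - (w.2.re * w.2.re + w.2.im * w.2.im) := by
    funext w; simp [quad, Complex.normSq_apply]
  rw [this]
  have h1 : ContDiff ℝ ∞ (fun w : Amb => w.1.re) := Complex.reCLM.contDiff.comp contDiff_fst
  have h2 : ContDiff ℝ ∞ (fun w : Amb => w.1.im) := Complex.imCLM.contDiff.comp contDiff_fst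
  have h3 : ContDiff ℝ ∞ (fun w : Amb => w.2.re) := Complex.reCLM.contDiff.comp contDiff_snd
  have h4 : ContDiff ℝ ∞ (fun w : Amb => w.2.im) := Complex.imCLM.contDiff.comp contDiff_snd
  exact ((h1.mul h1).add (h2.mul h2)).sub ((h3.mul h3).add (h4.mul h4))

theorem isOpen_cone : IsOpen cone := isOpen_lt continuous_const contDiff_quad.continuous

theorem isSmooth_val : IsSmooth H31.val := by
  have h : ContDiffOn ℝ ∞ (fun w : Amb => (Real.sqrt (quad w))⁻¹ • w) cone := by
    refine ContDiffOn.smul (f := fun w : Amb => (Real.sqrt (quad w))⁻¹) (ContDiffOn.inv ?_ ?_)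
      contDiffOn_id
    · exact ContDiffOn.sqrt contDiff_quad.contDiffOn (fun w hw => (ne_of_gt hw))
    · intro w hw
      exact (Real.sqrt_pos.2 hw).ne'
  exact h.congr (fun w hw => retr_val w hw)

theorem retr_retr_val (w : Amb) : retr (retr w).val = retr w := retr_of_val _

theorem retr_mapsTo : Set.MapsTo (fun w => (retr w).val) cone cone :=
  fun w _ => val_mem_cone (retr w)

theorem differentiableAt_of_isSmooth {E : Type*} [NormedAddCommGroup E] [NormedSpace ℝ E]
    {f : H31 → E} (hf : IsSmooth f) (p : H31) :
    DifferentiableAt ℝ (fun w => f (retr w)) p.val :=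
  (hf.differentiableOn (by simp)).differentiableAt (isOpen_cone.mem_nhds (val_mem_cone p))

theorem isSmooth_dirDeriv {E : Type*} [NormedAddCommGroup E] [NormedSpace ℝ E] {f : H31 → E}
    (hf : IsSmooth f) {X : H31 → Amb} (hX : IsSmooth X) :
    IsSmooth (fun p => dirDeriv f p (X p)) := by
  have h1 : ContDiffOn ℝ ∞ (fderiv ℝ (fun w => f (retr w))) cone :=
    ContDiffOn.fderiv_of_isOpen hf isOpen_cone (by simp)
  have h2 : ContDiffOn ℝ ∞ (fun w => fderiv ℝ (fun w => f (retr w)) (retr w).val) cone :=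
    h1.comp isSmooth_val retr_mapsTo
  exact h2.clm_apply hX

theorem hasDerivAt_bil {a b : ℝ → Amb} {a' b' : Amb} {s : ℝ} (ha : HasDerivAt a a' s)
    (hb : HasDerivAt b b' s) :
    HasDerivAt (fun r => bil (a r) (b r)) (bil a' (b s) + bil (a s) b') s := by
  have fst {c : ℝ → Amb} {c' : Amb} (h : HasDerivAt c c' s) :
      HasDerivAt (fun r => (c r).1) c'.1 s :=
    (ContinuousLinearMap.fst ℝ ℂ ℂ).hasFDerivAt.comp_hasDerivAt s h
  have snd {c : ℝ → Amb} {c' : Amb} (h : HasDerivAt c c' s) :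
      HasDerivAt (fun r => (c r).2) c'.2 s :=
    (ContinuousLinearMap.snd ℝ ℂ ℂ).hasFDerivAt.comp_hasDerivAt s h
  have re {c : ℝ → ℂ} {c' : ℂ} (h : HasDerivAt c c' s) :
      HasDerivAt (fun r => (c r).re) c'.re s := Complex.reCLM.hasFDerivAt.comp_hasDerivAt s h
  have im {c : ℝ → ℂ} {c' : ℂ} (h : HasDerivAt c c' s) :
      HasDerivAt (fun r => (c r).im) c'.im s := Complex.imCLM.hasFDerivAt.comp_hasDerivAt s h
  simp only [bil_eq]
  refine HasDerivAt.congr_deriv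
    ((((re (fst ha)).mul (re (fst hb))).add ((im (fst ha)).mul (im (fst hb)))).sub
      (((re (snd ha)).mul (re (snd hb))).add ((im (snd ha)).mul (im (snd hb))))) ?_
  ring

/-- Differentiating the tangency of a vector field. -/
theorem bil_dirDeriv (X Y : VF) (p : H31) :
    bil p.val (dirDeriv Y.1 p (X.1 p)) = - bil (X.1 p) (Y.1 p) := by
  have hp : quad p.val = 1 := p.quad_val
  set v := X.1 p
  -- the retraction has derivative `v + (multiple of p)` at `p` in the direction `v`
  have h1 : HasDerivAt (fun s : ℝ => p.val + s • v) v 0 := by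
    simpa using ((hasDerivAt_id (0 : ℝ)).smul_const v).const_add p.val
  have hc : DifferentiableAt ℝ (fun w : Amb => (Real.sqrt (quad w))⁻¹) p.val := by
    have hq : DifferentiableAt ℝ quad p.val := contDiff_quad.differentiable (by simp) _
    refine DifferentiableAt.inv (hq.sqrt (by simp [hp])) (by simp [hp])
  have h2 : HasDerivAt (fun s : ℝ => (Real.sqrt (quad (p.val + s • v)))⁻¹)
      (fderiv ℝ (fun w : Amb => (Real.sqrt (quad w))⁻¹) p.val v) 0 := by
    have := hc.hasFDerivAt.hasLineDerivAt v
    exact this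
  have h3 := h2.smul h1
  have h4 : HasDerivAt (fun s : ℝ => (retr (p.val + s • v)).val)
      ((Real.sqrt (quad (p.val + (0 : ℝ) • v)))⁻¹ • v
        + (fderiv ℝ (fun w : Amb => (Real.sqrt (quad w))⁻¹) p.val v) • (p.val + (0 : ℝ) • v)) 0 := by
    refine h3.congr_of_eventuallyEq ?_
    have hcont : ContinuousAt (fun s : ℝ => p.val + s • v) 0 := h1.continuousAt
    have : ∀ᶠ s : ℝ in nhds 0, p.val + s • v ∈ cone :=
      hcont.eventually (isOpen_cone.mem_nhds (by simpa using val_mem_cone p))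
    filter_upwards [this] with s hs
    exact retr_val _ hs
  have h5 : HasDerivAt (fun s : ℝ => Y.1 (retr (p.val + s • v))) (dirDeriv Y.1 p v) 0 :=
    (differentiableAt_of_isSmooth Y.2.1 p).hasFDerivAt.hasLineDerivAt v
  have h6 := hasDerivAt_bil h4 h5
  have h7 : (fun s : ℝ => bil (retr (p.val + s • v)).val (Y.1 (retr (p.val + s • v))))
      = fun _ => 0 := by
    funext s
    exact Y.2.2 _
  rw [h7] at h6
  have h8 := h6.unique (hasDerivAt_const (0 : ℝ) (0 : ℝ))
  simp only [zero_smul, add_zero, retr_of_val, hp, Real.sqrt_one, inv_one, one_smul] at h8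
  have h9 : bil p.val (Y.1 p) = 0 := Y.2.2 p
  rw [bil_eq] at h8 h9
  rw [bil_eq (X.1 p)]
  simp only [Prod.fst_add, Prod.snd_add, Complex.add_re, Complex.add_im, Prod.smul_fst,
    Prod.smul_snd, Complex.smul_re, Complex.smul_im, smul_eq_mul] at h8
  linear_combination h8 - (fderiv ℝ (fun w : Amb => (Real.sqrt (quad w))⁻¹) p.val v) * h9

/-- The Lie bracket of vector fields, `[X, Y] = D_X Y - D_Y X` in the ambient space. -/
def bracket (X Y : VF) : VF :=
  ⟨fun p => dirDeriv Y.1 p (X.1 p) - dirDeriv X.1 p (Y.1 p),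
    ContDiffOn.sub (isSmooth_dirDeriv Y.2.1 X.2.1) (isSmooth_dirDeriv X.2.1 Y.2.1), by
      intro p
      have h1 := bil_dirDeriv X Y p
      have h2 := bil_dirDeriv Y X p
      change bil p.val (_ - _) = 0
      rw [bil_eq] at h1 h2 ⊢
      rw [bil_eq] at h1 h2
      simp only [Prod.fst_sub, Prod.snd_sub, Complex.sub_re, Complex.sub_im]
      linear_combination h1 - h2⟩

/-! ### Tensor fields, metrics and connections on the hypersurface

Tensor fields are multilinear maps over the algebra of smooth functions. -/

/-- Fields of endomorphisms (tensor fields of type `(1,1)`). -/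
abbrev EndField : Type := VF →ₗ[Fn] VF

/-- One-forms. -/
abbrev OneForm : Type := VF →ₗ[Fn] Fn

/-- Covariant 2-tensors. -/
abbrev Tensor2 : Type := VF →ₗ[Fn] VF →ₗ[Fn] Fn

/-- Covariant 3-tensors, `(X, Y, Z) ↦ T X Y Z`. -/
abbrev Tensor3 : Type := VF →ₗ[Fn] VF →ₗ[Fn] VF →ₗ[Fn] Fn

/-- Tensor fields of type `(1,2)`, `(X, Y) ↦ S_X Y`. -/
abbrev Tensor12 : Type := VF →ₗ[Fn] VF →ₗ[Fn] VF

/-- `α ⊗ β`. -/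
def tensor (a b : OneForm) : Tensor2 := a.smulRight b

/-- `α ∧ β = α ⊗ β - β ⊗ α`. -/
def wedge (a b : OneForm) : Tensor2 := tensor a b - tensor b a

/-- `α ⊗ B` for a one-form `α` and a 2-tensor `B`. -/
def tensor3 (a : OneForm) (B : Tensor2) : Tensor3 := a.smulRight B

/-- `V ⊗ α`, the endomorphism field `Y ↦ α(Y) V`. -/
def tensorVec (V : VF) (a : OneForm) : EndField := a.smulRight V

/-- A Lorentzian metric: a symmetric covariant 2-tensor of signature `(-,+,+)` at every point. -/
structure IsLorentzian (g : Tensor2) : Prop where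
  symm : ∀ X Y, g X Y = g Y X
  signature : ∀ p : H31, ∃ E : Fin 3 → VF,
    (∀ i j, (g (E i) (E j)).1 p = if i = j then (if i = 0 then -1 else 1) else 0) ∧
    Submodule.span ℝ (Set.range fun i => (E i).1 p) = TSpace p

/-- Affine connections on the hypersurface. -/
@[ext]
structure Connection where
  /-- `∇_X Y` -/
  nabla : VF → VF → VF
  add_left : ∀ X X' Y, nabla (X + X') Y = nabla X Y + nabla X' Y
  smul_left : ∀ (f : Fn) X Y, nabla (f • X) Y = f • nabla X Y
  add_right : ∀ X Y Y', nabla X (Y + Y') = nabla X Y + nabla X Y'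
  leibniz : ∀ (f : Fn) (X Y : VF) (p : H31), (nabla X (f • Y)).1 p
    = f.1 p • (nabla X Y).1 p + dirDeriv f.1 p (X.1 p) • Y.1 p

/-- The connection `∇ - S`. -/
def Connection.subTensor (D : Connection) (S : Tensor12) : Connection where
  nabla X Y := D.nabla X Y - S X Y
  add_left X X' Y := by
    rw [D.add_left, map_add, LinearMap.add_apply]; abel
  smul_left f X Y := by
    rw [D.smul_left, map_smul, LinearMap.smul_apply, smul_sub]
  add_right X Y Y' := by
    rw [D.add_right, map_add]; abel
  leibniz f X Y p := by
    have h := D.leibniz f X Y p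
    rw [map_smul]
    change (D.nabla X (f • Y)).1 p - f.1 p • (S X Y).1 p
      = f.1 p • ((D.nabla X Y).1 p - (S X Y).1 p) + dirDeriv f.1 p (X.1 p) • Y.1 p
    rw [h, smul_sub]; abel

/-- `∇ g = 0`. -/
def Connection.IsMetric (D : Connection) (g : Tensor2) : Prop :=
  ∀ (X Y Z : VF) (p : H31), dirDeriv (g Y Z).1 p (X.1 p)
    = (g (D.nabla X Y) Z).1 p + (g Y (D.nabla X Z)).1 p

/-- `∇_X Y - ∇_Y X = [X, Y]`. -/
def Connection.IsTorsionFree (D : Connection) : Prop :=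
  ∀ X Y : VF, D.nabla X Y - D.nabla Y X = bracket X Y

/-- `∇` is the Levi-Civita connection of `g`. -/
structure Connection.IsLeviCivita (D : Connection) (g : Tensor2) : Prop where
  metric : D.IsMetric g
  torsionFree : D.IsTorsionFree

/-- `R(X,Y)Z = ∇_X ∇_Y Z - ∇_Y ∇_X Z - ∇_{[X,Y]} Z`. -/
def Connection.curv (D : Connection) (X Y Z : VF) : VF :=
  D.nabla X (D.nabla Y Z) - D.nabla Y (D.nabla X Z) - D.nabla (bracket X Y) Z

/-- `S` is a homogeneous pseudo-Riemannian structure for the metric `g` with Levi-Civita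
connection `D`: for `∇' = ∇ - S` one has `∇' g = 0`, `∇' R = 0` and `∇' S = 0`. -/
structure IsHomogeneousStructure (g : Tensor2) (D : Connection) (S : Tensor12) : Prop where
  metric : (D.subTensor S).IsMetric g
  curvature : ∀ W X Y Z : VF, (D.subTensor S).nabla W (D.curv X Y Z)
    = D.curv ((D.subTensor S).nabla W X) Y Z + D.curv X ((D.subTensor S).nabla W Y) Z
      + D.curv X Y ((D.subTensor S).nabla W Z)
  self : ∀ W X Y : VF, (D.subTensor S).nabla W (S X Y)
    = S ((D.subTensor S).nabla W X) Y + S X ((D.subTensor S).nabla W Y)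

/-- `(φ, ξ, η)` is an almost contact structure compatible with `g`; here `ε = g(ξ, ξ) = ±1`. -/
structure IsAlmostContactMetric (g : Tensor2) (phi : EndField) (xi : VF) (eta : OneForm) :
    Prop where
  sq : ∀ X, phi (phi X) = -X + eta X • xi
  eta_xi : eta xi = 1
  unit : g xi xi = 1 ∨ g xi xi = -1
  compat : ∀ X Y, g (phi X) (phi Y) = g X Y - g xi xi * (eta X * eta Y)

/-- The almost contact metric structure `(g, φ, ξ, η)` is `α`-Sasakian:
`(∇_X φ)Y = α (g(X,Y) ξ - ε η(Y) X)`. -/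
structure IsAlphaSasakian (alpha : Fn) (g : Tensor2) (D : Connection) (phi : EndField) (xi : VF)
    (eta : OneForm) : Prop where
  almostContact : IsAlmostContactMetric g phi xi eta
  nabla_phi : ∀ X Y, D.nabla X (phi Y) - phi (D.nabla X Y)
    = alpha • (g X Y • xi - (g xi xi * eta Y) • X)

/-- `(S, φ, ξ, η)` is a homogeneous almost contact metric structure: `S` is a homogeneous
structure and `φ`, `ξ`, `η` are parallel for `∇ - S`. -/
structure IsHomogeneousAlmostContact (g : Tensor2) (D : Connection) (S : Tensor12)
    (phi : EndField) (xi : VF) (eta : OneForm) : Prop where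
  almostContact : IsAlmostContactMetric g phi xi eta
  homogeneous : IsHomogeneousStructure g D S
  phi_parallel : ∀ X Y, (D.subTensor S).nabla X (phi Y) = phi ((D.subTensor S).nabla X Y)
  xi_parallel : ∀ X, (D.subTensor S).nabla X xi = 0
  eta_parallel : ∀ (X Y : VF) (p : H31), dirDeriv (eta Y).1 p (X.1 p)
    = (eta ((D.subTensor S).nabla X Y)).1 p

/-! ### Diffeomorphisms and invariance -/

/-- `F` is a diffeomorphism of the hypersurface. -/
def IsDiffeo (F : H31 → H31) : Prop :=
  IsSmooth (fun p => (F p).val) ∧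
    ∃ F' : H31 → H31, IsSmooth (fun p => (F' p).val) ∧ Function.LeftInverse F' F ∧
      Function.RightInverse F' F

/-- `X'` is the push-forward of `X` by `F`: `dF_p (X_p) = X'_{F(p)}`. -/
def Related (F : H31 → H31) (X X' : VF) : Prop :=
  ∀ p, dirDeriv (fun q => (F q).val) p (X.1 p) = X'.1 (F p)

/-- `F` is an isometry of `g`. -/
def IsIsometry (g : Tensor2) (F : H31 → H31) : Prop :=
  IsDiffeo F ∧ ∀ X Y X' Y', Related F X X' → Related F Y Y' →
    ∀ p, (g X' Y').1 (F p) = (g X Y).1 p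

/-- `F` preserves the connection. -/
def PreservesConnection (F : H31 → H31) (D : Connection) : Prop :=
  ∀ X Y X' Y', Related F X X' → Related F Y Y' → Related F (D.nabla X Y) (D.nabla X' Y')

/-- `F` preserves the tensor fields `S`, `φ`, `ξ`, `η`. -/
structure PreservesContact (F : H31 → H31) (S : Tensor12) (phi : EndField) (xi : VF)
    (eta : OneForm) : Prop where
  tensor : ∀ X Y X' Y', Related F X X' → Related F Y Y' → Related F (S X Y) (S X' Y')
  endo : ∀ X X', Related F X X' → Related F (phi X) (phi X')
  reeb : Related F xi xi
  form : ∀ X X', Related F X X' → ∀ p, (eta X').1 (F p) = (eta X).1 p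

/-! ### The left-invariant frame and the tensor fields built from it -/

/-- The identification of `(z₁, z₂)` with a `2 × 2` matrix. -/
def mat (w : Amb) : Matrix (Fin 2) (Fin 2) ℂ := !![w.1, w.2; conj w.2, conj w.1]

/-- The basis `X₀, X₁, X₂` of `su(1,1)`. -/
def pauli : Fin 3 → Matrix (Fin 2) (Fin 2) ℂ :=
  ![!![Complex.I, 0; 0, -Complex.I], !![0, 1; 1, 0], !![0, Complex.I; -Complex.I, 0]]

/-- The vectors `X₀, X₁, X₂` at the point `w`. -/
def frameAt (i : Fin 3) (w : Amb) : Amb :=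
  ![(Complex.I * w.1, -Complex.I * w.2), (w.2, w.1), (-Complex.I * w.2, Complex.I * w.1)] i

/-- The frame is left-invariant: `X_i` at `w` is `w X_i` in terms of matrices. -/
theorem mat_frameAt (i : Fin 3) (w : Amb) : mat (frameAt i w) = mat w * pauli i := by
  fin_cases i <;> ext a b <;> fin_cases a <;> fin_cases b <;>
    simp [mat, frameAt, pauli, Matrix.mul_apply, Fin.sum_univ_two, mul_comm]

/-- The coordinates of `w⁻¹ v` with respect to `X₀, X₁, X₂`, where `w` lies on the hypersurface
and `v` is tangent at `w`. -/
def coframeAt (i : Fin 3) (w v : Amb) : ℝ :=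
  ![(conj w.1 * v.1 - w.2 * conj v.2).im, (conj w.1 * v.2 - w.2 * conj v.1).re,
    (conj w.1 * v.2 - w.2 * conj v.1).im] i

theorem contDiff_frameAt (i : Fin 3) : ContDiff ℝ ∞ (frameAt i) := by
  have h1 : ContDiff ℝ ∞ (fun w : Amb => w.1) := contDiff_fst
  have h2 : ContDiff ℝ ∞ (fun w : Amb => w.2) := contDiff_snd
  fin_cases i
  · exact (contDiff_const.mul h1).prodMk (contDiff_const.mul h2)
  · exact h2.prodMk h1
  · exact (contDiff_const.mul h2).prodMk (contDiff_const.mul h1)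

/-- The left-invariant vector fields `X₀, X₁, X₂`. -/
def frame (i : Fin 3) : VF :=
  ⟨fun p => frameAt i p.val, (contDiff_frameAt i).comp_contDiffOn isSmooth_val, by
    intro p
    change bil _ _ = 0
    rw [bil_eq]
    fin_cases i <;> simp [frameAt] <;> ring⟩

theorem isSmooth_coframeAt (i : Fin 3) {X : H31 → Amb} (hX : IsSmooth X) :
    IsSmooth (fun p => coframeAt i p.val (X p)) := by
  have fst {f : H31 → Amb} (hf : IsSmooth f) : IsSmooth (fun p => (f p).1) :=
    contDiff_fst.comp_contDiffOn hf
  have snd {f : H31 → Amb} (hf : IsSmooth f) : IsSmooth (fun p => (f p).2) :=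
    contDiff_snd.comp_contDiffOn hf
  have cj {f : H31 → ℂ} (hf : IsSmooth f) : IsSmooth (fun p => conj (f p)) :=
    Complex.conjCLE.contDiff.comp_contDiffOn hf
  have re {f : H31 → ℂ} (hf : IsSmooth f) : IsSmooth (fun p => (f p).re) :=
    Complex.reCLM.contDiff.comp_contDiffOn hf
  have im {f : H31 → ℂ} (hf : IsSmooth f) : IsSmooth (fun p => (f p).im) :=
    Complex.imCLM.contDiff.comp_contDiffOn hf
  have ml {f h : H31 → ℂ} (hf : IsSmooth f) (hh : IsSmooth h) : IsSmooth (fun p => f p * h p) :=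
    ContDiffOn.mul hf hh
  have sb {f h : H31 → ℂ} (hf : IsSmooth f) (hh : IsSmooth h) : IsSmooth (fun p => f p - h p) :=
    ContDiffOn.sub hf hh
  have z := isSmooth_val
  fin_cases i
  · exact im (sb (ml (cj (fst z)) (fst hX)) (ml (snd z) (cj (snd hX))))
  · exact re (sb (ml (cj (fst z)) (snd hX)) (ml (snd z) (cj (fst hX))))
  · exact im (sb (ml (cj (fst z)) (snd hX)) (ml (snd z) (cj (fst hX))))

/-- The dual left-invariant one-forms `θ⁰, θ¹, θ²`. -/
def coframe (i : Fin 3) : OneForm where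
  toFun X := ⟨fun p => coframeAt i p.val (X.1 p), isSmooth_coframeAt i X.2.1⟩
  map_add' X Y := by
    apply Subtype.ext
    funext p
    change coframeAt i p.val (X.1 p + Y.1 p)
      = coframeAt i p.val (X.1 p) + coframeAt i p.val (Y.1 p)
    fin_cases i <;> simp [coframeAt] <;> ring
  map_smul' f X := by
    apply Subtype.ext
    funext p
    change coframeAt i p.val (f.1 p • X.1 p) = f.1 p * coframeAt i p.val (X.1 p)
    fin_cases i <;> simp [coframeAt] <;> ring

theorem coframe_frame (i j : Fin 3) : coframe i (frame j) = if i = j then 1 else 0 := by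
  apply Subtype.ext
  funext p
  have hp := p.quad_val
  simp only [quad, Complex.normSq_apply] at hp
  change coframeAt i p.val (frameAt j p.val) = _
  fin_cases i <;> fin_cases j <;> 
    simp [coframeAt, frameAt, Fn.one_apply, Fn.zero_apply] <;> linarith

/-- Every vector field is `X = θ⁰(X) X₀ + θ¹(X) X₁ + θ²(X) X₂`. -/
theorem frame_expansion (X : VF) : X = ∑ i, coframe i X • frame i := by
  apply Subtype.ext
  funext p
  have hp := p.quad_val
  have ht : bil p.val (X.1 p) = 0 := X.2.2 p
  rw [bil_eq] at ht
  simp only [quad, Complex.normSq_apply] at hp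
  rw [Fin.sum_univ_three]
  change X.1 p = coframeAt 0 p.val (X.1 p) • frameAt 0 p.val
    + coframeAt 1 p.val (X.1 p) • frameAt 1 p.val + coframeAt 2 p.val (X.1 p) • frameAt 2 p.val
  generalize X.1 p = v at *
  generalize p.val = w at *
  apply Prod.ext <;> apply Complex.ext <;> simp [coframeAt, frameAt]
  · linear_combination (-v.1.re) * hp + w.1.re * ht
  · linear_combination (-v.1.im) * hp + w.1.im * ht
  · linear_combination (-v.2.re) * hp + w.2.re * ht
  · linear_combination (-v.2.im) * hp + w.2.im * ht

/-- A constant, as a smooth function. -/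
def cst (r : ℝ) : Fn := algebraMap ℝ Fn r

/-- The metric `g = lam θ⁰⊗θ⁰ + mu θ¹⊗θ¹ + nu θ²⊗θ²` of Kaluza-Klein type. -/
def kkMetric (lam mu nu : ℝ) : Tensor2 :=
  cst lam • tensor (coframe 0) (coframe 0) + cst mu • tensor (coframe 1) (coframe 1)
    + cst nu • tensor (coframe 2) (coframe 2)

/-- The covariant 3-tensor `- lam θ²⊗(θ⁰∧θ¹) + t θ⁰⊗(θ¹∧θ²) - lam θ¹⊗(θ²∧θ⁰)`. -/
def sLamCov (lam t : ℝ) : Tensor3 :=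
  cst (-lam) • tensor3 (coframe 2) (wedge (coframe 0) (coframe 1))
    + cst t • tensor3 (coframe 0) (wedge (coframe 1) (coframe 2))
    + cst (-lam) • tensor3 (coframe 1) (wedge (coframe 2) (coframe 0))

/-- The covariant 3-tensor `T` with its last index raised by the metric `diag(lam, mu, nu)`. -/
def raise (lam mu nu : ℝ) (T : Tensor3) : Tensor12 :=
  LinearMap.mk₂ Fn
    (fun X Y => ∑ i, (cst ((![lam, mu, nu] i)⁻¹) * T X Y (frame i)) • frame i)
    (by
      intro X X' Y
      rw [← Finset.sum_add_distrib]
      refine Finset.sum_congr rfl fun i _ => ?_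
      rw [map_add, LinearMap.add_apply, LinearMap.add_apply, mul_add, add_smul])
    (by
      intro c X Y
      rw [Finset.smul_sum]
      refine Finset.sum_congr rfl fun i _ => ?_
      rw [map_smul, LinearMap.smul_apply, LinearMap.smul_apply, smul_smul, smul_eq_mul]
      congr 1
      ring)
    (by
      intro X Y Y'
      rw [← Finset.sum_add_distrib]
      refine Finset.sum_congr rfl fun i _ => ?_
      rw [map_add, LinearMap.add_apply, mul_add, add_smul])
    (by
      intro c X Y
      rw [Finset.smul_sum]
      refine Finset.sum_congr rfl fun i _ => ?_
      rw [map_smul, LinearMap.smul_apply, smul_smul, smul_eq_mul]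
      congr 1
      ring)

/-- `g(S_X Y, Z) = T(X, Y, Z)` for the tensor field `S` obtained from `T` by raising the index. -/
theorem kkMetric_raise {lam mu nu : ℝ} (h0 : lam ≠ 0) (h1 : mu ≠ 0) (h2 : nu ≠ 0) (T : Tensor3)
    (X Y Z : VF) : kkMetric lam mu nu (raise lam mu nu T X Y) Z = T X Y Z := by
  have hc : ∀ r : ℝ, r ≠ 0 → cst r * cst r⁻¹ = 1 := by
    intro r hr
    rw [cst, cst, ← map_mul, mul_inv_cancel₀ hr, map_one]
  have hT : T X Y Z = ∑ i, coframe i Z * T X Y (frame i) := by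
    conv_lhs => rw [frame_expansion Z]
    simp [map_sum]
  rw [hT]
  simp only [kkMetric, raise, tensor, LinearMap.mk₂_apply, Fin.sum_univ_three,
    LinearMap.add_apply, LinearMap.smul_apply, LinearMap.smulRight_apply, map_add, map_smul,
    coframe_frame, smul_eq_mul]
  simp
  linear_combination (coframe 0 Z * T X Y (frame 0)) * hc lam h0
    + (coframe 1 Z * T X Y (frame 1)) * hc mu h1 + (coframe 2 Z * T X Y (frame 2)) * hc nu h2

/-- The tensor field `S_λ(t)` of type `(1,2)`. -/
def sLam (lam mu nu t : ℝ) : Tensor12 := raise lam mu nu (sLamCov lam t)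

/-- The Reeb vector field `ξ₀ = X₀ / √|lam|`. -/
def xi0 (lam : ℝ) : VF := cst (Real.sqrt |lam|)⁻¹ • frame 0

/-- The contact form `η₀ = √|lam| θ⁰`. -/
def eta0 (lam : ℝ) : OneForm := cst (Real.sqrt |lam|) • coframe 0

/-- `φ₀ = (X₁/√mu) ⊗ (√nu θ²) - (X₂/√nu) ⊗ (√mu θ¹)`. -/
def phi0 (mu nu : ℝ) : EndField :=
  tensorVec (cst (Real.sqrt mu)⁻¹ • frame 1) (cst (Real.sqrt nu) • coframe 2)
    - tensorVec (cst (Real.sqrt nu)⁻¹ • frame 2) (cst (Real.sqrt mu) • coframe 1)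

/-! ### The groups `U(1,1)`, `SU(1,1)` and their actions -/

/-- Complex `2 × 2` matrices. -/
abbrev Mat : Type := Matrix (Fin 2) (Fin 2) ℂ

/-- The matrix `diag(1, -1)` of the Hermitian form of signature `(1,1)`. -/
def herm : Mat := !![1, 0; 0, -1]

/-- `M` preserves the Hermitian form `|z₁|² - |z₂|²`. -/
def IsU (M : Mat) : Prop := M.conjTranspose * herm * M = herm

/-- `M` preserves the Hermitian form `|z₁|² - |z₂|²` and has determinant one. -/
def IsSU (M : Mat) : Prop := IsU M ∧ M.det = 1

theorem IsU.mul {M N : Mat} (hM : IsU M) (hN : IsU N) : IsU (M * N) := by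
  unfold IsU at *
  rw [Matrix.conjTranspose_mul]
  calc N.conjTranspose * M.conjTranspose * herm * (M * N)
      = N.conjTranspose * (M.conjTranspose * herm * M) * N := by simp only [Matrix.mul_assoc]
    _ = herm := by rw [hM, hN]

theorem IsU.one : IsU 1 := by simp [IsU]

theorem IsU.of_mul_eq_one {M N : Mat} (hM : IsU M) (h : M * N = 1) : IsU N := by
  unfold IsU at *
  have h' : N.conjTranspose * M.conjTranspose = 1 := by
    rw [← Matrix.conjTranspose_mul, h, Matrix.conjTranspose_one]
  calc N.conjTranspose * herm * N
      = N.conjTranspose * (M.conjTranspose * herm * M) * N := by rw [hM]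
    _ = (N.conjTranspose * M.conjTranspose) * herm * (M * N) := by simp only [Matrix.mul_assoc]
    _ = herm := by rw [h, h', Matrix.one_mul, Matrix.mul_one]

theorem IsSU.mul {M N : Mat} (hM : IsSU M) (hN : IsSU N) : IsSU (M * N) :=
  ⟨hM.1.mul hN.1, by rw [Matrix.det_mul, hM.2, hN.2, one_mul]⟩

theorem IsSU.mat (p : H31) : IsSU (mat p.val) := by
  have hp := p.quad_val
  have hq : p.val.1 * conj p.val.1 - p.val.2 * conj p.val.2 = 1 := by
    rw [Complex.mul_conj, Complex.mul_conj]
    exact_mod_cast hp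
  refine ⟨?_, ?_⟩
  · unfold IsU
    ext i j
    fin_cases i <;> fin_cases j <;>
      simp [AdS.mat, herm, Matrix.mul_apply, Fin.sum_univ_two, Matrix.conjTranspose_apply]
    · linear_combination hq
    · ring
    · ring
    · linear_combination -hq
  · simp only [AdS.mat, Matrix.det_fin_two_of]
    exact hq

/-- A matrix in `SU(1,1)` has the form `mat w`. -/
theorem IsSU.mat_eq {M : Mat} (h : IsSU M) : AdS.mat (M 0 0, M 0 1) = M := by
  obtain ⟨h1, h2⟩ := h
  have e1 : M * (herm * M.conjTranspose * herm) = 1 := by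
    apply mul_eq_one_comm.1
    have hh : herm * herm = 1 := by
      ext i j; fin_cases i <;> fin_cases j <;> simp [herm, Matrix.mul_apply]
    calc herm * M.conjTranspose * herm * M = herm * (M.conjTranspose * herm * M) := by
          simp only [Matrix.mul_assoc]
      _ = 1 := by rw [h1, hh]
  have e2 : M.adjugate = herm * M.conjTranspose * herm := by
    calc M.adjugate = M.adjugate * (M * (herm * M.conjTranspose * herm)) := by
          rw [e1, Matrix.mul_one]
      _ = (M.adjugate * M) * (herm * M.conjTranspose * herm) := (Matrix.mul_assoc _ _ _).symm
      _ = _ := by rw [Matrix.adjugate_mul, h2, one_smul, Matrix.one_mul]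
  rw [Matrix.adjugate_fin_two] at e2
  have h11 := congrFun (congrFun e2 0) 0
  have h10 := congrFun (congrFun e2 1) 0
  simp only [herm, Matrix.mul_apply, Fin.sum_univ_two, Matrix.conjTranspose_apply,
    Matrix.of_apply, Matrix.cons_val', Matrix.cons_val_zero, Matrix.cons_val_one,
    Matrix.cons_val_fin_one] at h11 h10
  simp at h11 h10
  ext i j
  fin_cases i <;> fin_cases j <;> simp [AdS.mat, h11, h10]

/-- The point of the hypersurface corresponding to a matrix in `SU(1,1)`. -/
def ofMat (M : Mat) (h : IsSU M) : H31 :=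
  ⟨(M 0 0, M 0 1), by
    have h1 := h.mat_eq
    have h2 := h.2
    rw [← h1] at h2
    simp only [mat, Matrix.det_fin_two_of, Complex.mul_conj] at h2
    simp only [quad]
    exact_mod_cast h2⟩

theorem mat_ofMat (M : Mat) (h : IsSU M) : mat (ofMat M h).val = M := h.mat_eq

theorem H31.ext_mat {p q : H31} (h : mat p.val = mat q.val) : p = q := by
  apply H31.ext
  have h0 := congrFun (congrFun h 0) 0
  have h1 := congrFun (congrFun h 0) 1
  simp [mat] at h0 h1
  exact Prod.ext h0 h1

/-- The group `U(1,1)`. -/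
def U11 : Subgroup (Matrix.GeneralLinearGroup (Fin 2) ℂ) where
  carrier := {A | IsU A.val}
  mul_mem' := fun ha hb => IsU.mul ha hb
  one_mem' := IsU.one
  inv_mem' := fun {A} ha => IsU.of_mul_eq_one ha A.mul_inv

/-- The group `SU(1,1)`. -/
def SU11 : Subgroup (Matrix.GeneralLinearGroup (Fin 2) ℂ) where
  carrier := {A | IsSU A.val}
  mul_mem' := fun ha hb => IsSU.mul ha hb
  one_mem' := ⟨IsU.one, Matrix.det_one⟩
  inv_mem' := fun {A} ha => ⟨IsU.of_mul_eq_one ha.1 A.mul_inv, by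
    have h : A.val.det * (A⁻¹).val.det = 1 := by
      rw [← Matrix.det_mul, A.mul_inv, Matrix.det_one]
    rwa [show A.val.det = 1 from ha.2, one_mul] at h⟩

/-- `SU(1,1)` acts on the hypersurface from the left: `A · Z = A Z`. -/
instance instActionSU : MulAction SU11 H31 where
  smul A p := ofMat (A.1.val * mat p.val) (IsSU.mul A.2 (IsSU.mat p))
  one_smul p := H31.ext_mat (by
    refine (mat_ofMat _ _).trans ?_
    exact Matrix.one_mul _)
  mul_smul A B p := H31.ext_mat (by
    refine (mat_ofMat _ _).trans ?_
    refine Eq.trans ?_ (mat_ofMat _ _).symm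
    have hB := mat_ofMat (B.1.val * mat p.val) (IsSU.mul B.2 (IsSU.mat p))
    refine Eq.trans ?_ (congrArg (fun N => A.1.val * N) hB).symm
    exact Matrix.mul_assoc _ _ _)

/-- The matrix `diag(u⁻¹, u)`. -/
def rot (u : Circle) : Mat := !![(u : ℂ)⁻¹, 0; 0, (u : ℂ)]

theorem isSU_rot (u : Circle) : IsSU (rot u) := by
  have hu : (u : ℂ) ≠ 0 := u.coe_ne_zero
  have hc : conj (u : ℂ) = (u : ℂ)⁻¹ := by rw [← Circle.coe_inv_eq_conj, Circle.coe_inv]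
  refine ⟨?_, by simp [rot, hu]⟩
  unfold IsU
  ext i j
  fin_cases i <;> fin_cases j <;>
    simp [rot, herm, Matrix.mul_apply, Fin.sum_univ_two, Matrix.conjTranspose_apply, hc, hu]

theorem rot_mul (u v : Circle) : rot (u * v) = rot v * rot u := by
  ext i j
  fin_cases i <;> fin_cases j <;>
    simp [rot, Matrix.mul_apply, Fin.sum_univ_two, mul_comm]

/-- `SU(1,1) × U(1)` acts on the hypersurface by `(A, u) · Z = A Z diag(u⁻¹, u)`. -/
instance instActionSUxU : MulAction (SU11 × Circle) H31 where
  smul a p := ofMat (a.1.1.val * mat p.val * rot a.2)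
    (IsSU.mul (IsSU.mul a.1.2 (IsSU.mat p)) (isSU_rot a.2))
  one_smul p := H31.ext_mat (by
    refine (mat_ofMat _ _).trans ?_
    have h : rot 1 = 1 := by
      ext i j; fin_cases i <;> fin_cases j <;> simp [rot]
    change (1 : Mat) * _ * rot 1 = _
    rw [h, Matrix.one_mul, Matrix.mul_one])
  mul_smul a b p := H31.ext_mat (by
    refine (mat_ofMat _ _).trans ?_
    refine Eq.trans ?_ (mat_ofMat _ _).symm
    have hb := mat_ofMat (b.1.1.val * mat p.val * rot b.2)
      (IsSU.mul (IsSU.mul b.1.2 (IsSU.mat p)) (isSU_rot b.2))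
    refine Eq.trans ?_ (congrArg (fun N => a.1.1.val * N * rot a.2) hb).symm
    change (a.1.1.val * b.1.1.val) * _ * rot (a.2 * b.2) = _
    rw [rot_mul]
    simp only [Matrix.mul_assoc])

/-- The matrix `diag(1, d⁻¹)`. -/
def detRot (d : ℂ) : Mat := !![1, 0; 0, d⁻¹]

theorem IsU.det_mul_conj {M : Mat} (h : IsU M) : conj M.det * M.det = 1 := by
  have h1 := congrArg Matrix.det h
  rw [Matrix.det_mul, Matrix.det_mul, Matrix.det_conjTranspose] at h1
  have h2 : herm.det = -1 := by simp [herm]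
  rw [h2] at h1
  have h3 : star M.det = conj M.det := rfl
  rw [h3] at h1
  linear_combination -h1

theorem IsU.isSU_mul {M : Mat} (h : IsU M) (p : H31) :
    IsSU (M * AdS.mat p.val * detRot M.det) := by
  have hd := h.det_mul_conj
  have hd0 : M.det ≠ 0 := fun h0 => by simp [h0] at hd
  have hc : conj M.det = M.det⁻¹ := eq_inv_of_mul_eq_one_left hd
  refine ⟨IsU.mul (IsU.mul h (IsSU.mat p).1) ?_, ?_⟩
  · unfold IsU
    ext i j
    fin_cases i <;> fin_cases j <;>
      simp [detRot, herm, Matrix.mul_apply, Fin.sum_univ_two, Matrix.conjTranspose_apply, hc, hd0]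
  · rw [Matrix.det_mul, Matrix.det_mul, (IsSU.mat p).2]
    simp [detRot, hd0]

/-- `U(1,1)` acts on the hypersurface by `B · Z = B Z diag(1, det B⁻¹)`. -/
instance instActionU : MulAction U11 H31 where
  smul B p := ofMat (B.1.val * mat p.val * detRot B.1.val.det) (IsU.isSU_mul B.2 p)
  one_smul p := H31.ext_mat (by
    refine (mat_ofMat _ _).trans ?_
    have h : detRot 1 = 1 := by
      ext i j; fin_cases i <;> fin_cases j <;> simp [detRot]
    change (1 : Mat) * _ * detRot (1 : Mat).det = _
    rw [Matrix.det_one, h, Matrix.one_mul, Matrix.mul_one])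
  mul_smul A B p := H31.ext_mat (by
    refine (mat_ofMat _ _).trans ?_
    refine Eq.trans ?_ (mat_ofMat _ _).symm
    have hB := mat_ofMat (B.1.val * mat p.val * detRot B.1.val.det) (IsU.isSU_mul B.2 p)
    refine Eq.trans ?_ (congrArg (fun N => A.1.val * N * detRot A.1.val.det) hB).symm
    have h : detRot (A.1.val.det * B.1.val.det) = detRot B.1.val.det * detRot A.1.val.det := by
      ext i j
      fin_cases i <;> fin_cases j <;>
        simp [detRot, Matrix.mul_apply, Fin.sum_univ_two, mul_comm]
    change (A.1.val * B.1.val) * _ * detRot (A.1.val * B.1.val).det = _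
    rw [Matrix.det_mul, h]
    simp only [Matrix.mul_assoc])

/-- The homomorphism `SU(1,1) × U(1) → U(1,1)`, `(A, u) ↦ u⁻¹ A`. -/
def toU11 : SU11 × Circle →* U11 where
  toFun a := ⟨(Circle.toUnits a.2)⁻¹ • a.1.1, by
    have hc : conj (a.2 : ℂ) = (a.2 : ℂ)⁻¹ := by rw [← Circle.coe_inv_eq_conj, Circle.coe_inv]
    have h1 : IsU a.1.1.val := a.1.2.1
    have h2 : (((Circle.toUnits a.2)⁻¹ • a.1.1 : Matrix.GeneralLinearGroup (Fin 2) ℂ)).val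
        = (a.2 : ℂ)⁻¹ • a.1.1.val := rfl
    change IsU _
    rw [h2]
    unfold IsU at *
    rw [Matrix.conjTranspose_smul, Matrix.smul_mul, Matrix.smul_mul, Matrix.mul_smul, h1,
      smul_smul]
    have h3 : star (a.2 : ℂ)⁻¹ * (a.2 : ℂ)⁻¹ = 1 := by
      rw [star_inv₀]
      change (conj (a.2 : ℂ))⁻¹ * _ = 1
      rw [hc, inv_inv, mul_inv_cancel₀ a.2.coe_ne_zero]
    rw [h3, one_smul]⟩
  map_one' := by
    apply Subtype.ext
    apply Units.ext
    simp
  map_mul' a b := by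
    apply Subtype.ext
    apply Units.ext
    change ((a.2 * b.2 : Circle) : ℂ)⁻¹ • (a.1.1.val * b.1.1.val)
      = ((a.2 : ℂ)⁻¹ • a.1.1.val) * ((b.2 : ℂ)⁻¹ • b.1.1.val)
    rw [smul_mul_smul_comm, Circle.coe_mul, mul_inv]

/-! ### Lie algebras, fundamental vector fields and reductive decompositions -/

/-- The matrix exponential, as an invertible matrix. -/
def expGL (Y : Mat) : Matrix.GeneralLinearGroup (Fin 2) ℂ := (Matrix.isUnit_exp Y).unit

/-- The Lie algebra `{Y | exp(sY) ∈ G for all real s}` of a matrix group `G`. -/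
def lieAlg (G : Subgroup (Matrix.GeneralLinearGroup (Fin 2) ℂ)) : Set Mat :=
  {Y | ∀ s : ℝ, expGL (s • Y) ∈ G}

/-- The vector field `X` is the fundamental (Killing) vector field `Y^*` generated by
`s ↦ exp(sY)` under the action of `G`. -/
def IsFundamental (G : Subgroup (Matrix.GeneralLinearGroup (Fin 2) ℂ)) [MulAction G H31]
    (Y : Mat) (X : VF) : Prop :=
  ∃ hY : Y ∈ lieAlg G, ∀ p : H31,
    HasDerivAt (fun s : ℝ => ((⟨expGL (s • Y), hY s⟩ : G) • p).val) (X.1 p) 0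

/-- `Lie(G) = h ⊕ m` is a reductive decomposition for the action of `G` on the hypersurface:
`h` is the Lie algebra of the isotropy group `H` at the base point and `m` is an
`Ad(H)`-invariant complement. -/
structure IsReductiveDecomposition (G : Subgroup (Matrix.GeneralLinearGroup (Fin 2) ℂ))
    [MulAction G H31] (h m : Submodule ℝ Mat) : Prop where
  isotropy : lieAlg ((MulAction.stabilizer G base).map G.subtype) = h
  sum : lieAlg G = (h ⊔ m : Submodule ℝ Mat)
  disjoint : Disjoint h m
  ad_invariant : ∀ k ∈ MulAction.stabilizer G base, ∀ Y ∈ m, k.1.val * Y * (k⁻¹).1.val ∈ m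

/-- `D` is the canonical connection of the decomposition `Lie(G) = h ⊕ m`: the `G`-invariant
connection with `D_{X^*} Y^* = - [X, Y]_m^*` at the base point for all `X, Y ∈ m`. -/
def IsCanonicalConnection (G : Subgroup (Matrix.GeneralLinearGroup (Fin 2) ℂ)) [MulAction G H31]
    (h m : Submodule ℝ Mat) (D : Connection) : Prop :=
  (∀ a : G, PreservesConnection (fun p => a • p) D) ∧
  ∃ star : Mat → VF, (∀ Y ∈ lieAlg G, IsFundamental G Y (star Y)) ∧
    ∀ X ∈ m, ∀ Y ∈ m, ∀ Z ∈ m, X * Y - Y * X - Z ∈ h →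
      (D.nabla (star X) (star Y)).1 base = - (star Z).1 base

/-- The holonomy algebra of `D` at the base point, for a connection with parallel curvature and
torsion: the Lie algebra of endomorphisms of the tangent space generated by all `R(X, Y)`, that is,
the smallest subspace which contains them and is closed under commutators. -/
def holonomy (D : Connection) : Submodule ℝ (Module.End ℝ (TSpace base)) :=
  sInf {L | (∀ E : Module.End ℝ (TSpace base),
      (∃ X Y : VF, ∀ Z : VF, E (Z.at base) = (D.curv X Y Z).at base) → E ∈ L) ∧
    ∀ U ∈ L, ∀ V ∈ L, U * V - V * U ∈ L}

/-- The decomposition `Lie(G) = h ⊕ m` is the one obtained from the homogeneous structure `S` on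
the manifold with Levi-Civita connection `D`: there are linear isomorphisms `Ph` of `hol` onto `h`
and `Pm` of `T` onto `m`, where `T` is the tangent space at the base point and `hol` the holonomy
algebra of `∇' = ∇ - S`, such that `Pm` is inverse to `X ↦ X^*` and such that together they carry
the brackets `[U, V] = UV - VU`, `[U, x] = U(x)`, `[x, y] = S_x y - S_y x - R'(x, y)` of
`hol ⊕ T` to the matrix commutator. -/
def IsInducedDecomposition (G : Subgroup (Matrix.GeneralLinearGroup (Fin 2) ℂ)) [MulAction G H31]
    (h m : Submodule ℝ Mat) (D : Connection) (S : Tensor12) : Prop :=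
  ∃ (Ph : holonomy (D.subTensor S) →ₗ[ℝ] Mat) (Pm : TSpace base →ₗ[ℝ] Mat),
    Function.Injective Ph ∧ Function.Injective Pm ∧
    LinearMap.range Ph = h ∧ LinearMap.range Pm = m ∧
    (∀ (x : TSpace base) (X : VF), IsFundamental G (Pm x) X → X.at base = x) ∧
    (∀ U V W : holonomy (D.subTensor S), W.1 = U.1 * V.1 - V.1 * U.1 →
      Ph U * Ph V - Ph V * Ph U = Ph W) ∧
    (∀ (U : holonomy (D.subTensor S)) (x : TSpace base),
      Ph U * Pm x - Pm x * Ph U = Pm (U.1 x)) ∧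
    (∀ (X Y : VF) (E : holonomy (D.subTensor S)),
      (∀ Z : VF, E.1 (Z.at base) = ((D.subTensor S).curv X Y Z).at base) →
      Pm (X.at base) * Pm (Y.at base) - Pm (Y.at base) * Pm (X.at base)
        = Pm ((S X Y - S Y X).at base) - Ph E)

/-- The group `G` acts by isometries preserving `S`, `φ`, `ξ`, `η`, and `Lie(G) = h ⊕ m` is the
reductive decomposition induced by the homogeneous almost contact metric structure
`(S, φ, ξ, η)`. -/
structure IsInducedBy (G : Subgroup (Matrix.GeneralLinearGroup (Fin 2) ℂ)) [MulAction G H31]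
    (h m : Submodule ℝ Mat) (g : Tensor2) (D : Connection) (S : Tensor12) (phi : EndField)
    (xi : VF) (eta : OneForm) : Prop where
  isometric : ∀ a : G, IsIsometry g (fun p => a • p)
  preserves : ∀ a : G, PreservesContact (fun p => a • p) S phi xi eta
  reductive : IsReductiveDecomposition G h m
  canonical : IsCanonicalConnection G h m (D.subTensor S)
  induced : IsInducedDecomposition G h m D S

/-- `h = span {diag(0, i)}`. -/
def hSub : Submodule ℝ Mat := Submodule.span ℝ {!![0, 0; 0, Complex.I]}

/-- `m = span {diag(i, - i t / (-lam)), X₁, X₂}`. -/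
def mSub (lam t : ℝ) : Submodule ℝ Mat :=
  Submodule.span ℝ {!![Complex.I, 0; 0, -Complex.I * ((t / -lam : ℝ) : ℂ)], !![0, 1; 1, 0],
    !![0, Complex.I; -Complex.I, 0]}

/-- `su(1,1) = span {X₀, X₁, X₂}`. -/
def su11 : Submodule ℝ Mat := Submodule.span ℝ (Set.range pauli)

end AdS
end

noncomputable section

namespace AdS

/-! ### Directional derivatives on the hypersurface -/

/-! With `-lam = mu = nu` the metric is `lam (θ⁰θ⁰ - θ¹θ¹ - θ²θ²)`, a constant multiple of the
Killing form, hence bi-invariant. Its Levi-Civita connection is therefore `∇_X Y = [X, Y] / 2` on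
left-invariant fields. All statements about tensors are checked in components with respect to the
left-invariant frame, where they become polynomial identities in the components and their
derivatives.

Put `τ = t / -lam` and let `J` be the rotation `X₁ ↦ X₂ ↦ -X₁`, `X₀ ↦ 0`. Subtracting `S` removes
all of `[X, Y] / 2` except one term: on the frame, `∇ - S` is `(1 - τ) θ⁰ ⊗ J` (`subTensor_nabla`).
The tensors `g`, `R`, `S`, `φ₀`, `ξ₀`, `η₀` have constant components invariant under `J`, so they
are parallel. Since `J` commutes with itself, the curvature of `∇ - S` is `(1 - τ) dθ⁰ ⊗ J = 2 (1 -
τ) (θ¹ ∧ θ²) ⊗ J` (`subTensor_curv`). The holonomy algebra is thus the line `ℝ J` when `τ ≠ 1` and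
zero when `τ = 1`; this is the dichotomy of the theorem (`mem_holonomy_iff`).

Each group acts by restrictions of real linear maps that fix `X₀` and rotate `X₁, X₂` by a constant
unit number, which is `det B⁻¹` for `B` in `U(1,1)` and `1` for `SU(1,1)` (`FrameRotation`).
Anything built with constant rotation-invariant coefficients is preserved, so isometry and
invariance hold for all groups at once.

The Lie algebras come from differentiating `exp(sY)` at `0`. The fundamental fields are again
restrictions of linear maps, so their covariant derivatives at the base point are explicit
(`subTensor_nabla_killing`). Sending `J` to `diag(0, -i)` and the tangent vector `(i a, z)` to the
matrix with diagonal `(i a, -i τ a)` and upper right entry `z` matches the brackets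
(`isInducedDecomposition`). The case `t = -lam` is the same computation with `h = 0`. -/

theorem bil_self (w : Amb) : bil w w = quad w := by
  rw [bil_eq]; simp [quad, Complex.normSq_apply]

/-- The radial retraction has derivative `v + k p` in the direction `v`. Differentiating `bil = 1`
along it gives `bil p v + k = 0`, and tangency of `v` forces `k = 0`. -/
theorem dirDeriv_val (p : H31) {v : Amb} (hv : v ∈ TSpace p) : dirDeriv H31.val p v = v := by
  have hp : quad p.val = 1 := p.quad_val
  have h1 : HasDerivAt (fun s : ℝ => p.val + s • v) v 0 := by
    simpa using ((hasDerivAt_id (0 : ℝ)).smul_const v).const_add p.val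
  have hc : DifferentiableAt ℝ (fun w : Amb => (Real.sqrt (quad w))⁻¹) p.val := by
    have hq : DifferentiableAt ℝ quad p.val := contDiff_quad.differentiable (by simp) _
    exact DifferentiableAt.inv (hq.sqrt (by simp [hp])) (by simp [hp])
  have h2 : HasDerivAt (fun s : ℝ => (Real.sqrt (quad (p.val + s • v)))⁻¹)
      (fderiv ℝ (fun w : Amb => (Real.sqrt (quad w))⁻¹) p.val v) 0 :=
    hc.hasFDerivAt.hasLineDerivAt v
  have h4 := (h2.smul h1).congr_of_eventuallyEq
    (f₁ := fun s : ℝ => (retr (p.val + s • v)).val) (by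
      have : ∀ᶠ s : ℝ in nhds 0, p.val + s • v ∈ cone :=
        h1.continuousAt.eventually (isOpen_cone.mem_nhds (by simpa using val_mem_cone p))
      filter_upwards [this] with s hs
      exact retr_val _ hs)
  have h5 : HasDerivAt (fun s : ℝ => (retr (p.val + s • v)).val) (dirDeriv H31.val p v) 0 :=
    (differentiableAt_of_isSmooth isSmooth_val p).hasFDerivAt.hasLineDerivAt v
  have h6 := h5.unique h4
  have h7 := hasDerivAt_bil h4 h4
  have h8 : (fun s : ℝ => bil (retr (p.val + s • v)).val (retr (p.val + s • v)).val)
      = fun _ => 1 := by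
    funext s
    rw [bil_self]
    exact (retr (p.val + s • v)).quad_val
  rw [h8] at h7
  have h9 := h7.unique (hasDerivAt_const (0 : ℝ) (1 : ℝ))
  have h10 : bil p.val v = 0 := hv
  have h11 : bil p.val p.val = 1 := by rw [bil_self, hp]
  simp only [zero_smul, add_zero, retr_of_val, hp, Real.sqrt_one, inv_one, one_smul] at h6 h9
  have hk : fderiv ℝ (fun w : Amb => (Real.sqrt (quad w))⁻¹) p.val v = 0 := by
    generalize fderiv ℝ (fun w : Amb => (Real.sqrt (quad w))⁻¹) p.val v = k at *
    rw [bil_eq] at h9 h10 h11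
    rw [bil_eq] at h9
    simp only [Prod.fst_add, Prod.snd_add, Complex.add_re, Complex.add_im, Prod.smul_fst,
      Prod.smul_snd, Complex.smul_re, Complex.smul_im, smul_eq_mul] at h9
    linear_combination h9 / 2 - h10 - k * h11
  rw [h6, hk, zero_smul, add_zero]

section Vector

variable {E : Type*} [NormedAddCommGroup E] [NormedSpace ℝ E]

/-- Chain rule for the radial extensions: extending `F` and then `f` gives the extension of `f ∘ F`,
because the retraction fixes the hypersurface. -/
theorem dirDeriv_comp {F : H31 → H31} (hF : IsSmooth fun p => (F p).val) {f : H31 → E}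
    (hf : IsSmooth f) (p : H31) (v : Amb) :
    dirDeriv (fun q => f (F q)) p v
      = dirDeriv f (F p) (dirDeriv (fun q => (F q).val) p v) := by
  have h1 := (differentiableAt_of_isSmooth hF p).hasFDerivAt
  have h2 := (differentiableAt_of_isSmooth hf (F p)).hasFDerivAt
  have h2' : HasFDerivAt (fun w => f (retr w)) (fderiv ℝ (fun w => f (retr w)) (F p).val)
      ((fun w => (F (retr w)).val) p.val) := by
    simpa only [retr_of_val] using h2
  have h3 := h2'.comp p.val h1
  have h4 : (fun w => f (retr w)) ∘ (fun w => (F (retr w)).val) = fun w => f (F (retr w)) := by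
    funext w
    exact congrArg f (retr_of_val _)
  rw [h4] at h3
  unfold dirDeriv
  rw [h3.fderiv]
  rfl

theorem isSmooth_clm (L : Amb →L[ℝ] E) : IsSmooth fun p => L p.val :=
  L.contDiff.comp_contDiffOn isSmooth_val

theorem dirDeriv_clm (L : Amb →L[ℝ] E) (p : H31) {v : Amb} (hv : v ∈ TSpace p) :
    dirDeriv (fun q => L q.val) p v = L v := by
  have h1 := (differentiableAt_of_isSmooth isSmooth_val p).hasFDerivAt
  have h2 := L.hasFDerivAt.comp p.val h1
  have h3 := dirDeriv_val p hv
  unfold dirDeriv at h3 ⊢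
  change fderiv ℝ (⇑L ∘ fun w => (retr w).val) p.val v = _
  rw [h2.fderiv]
  exact congrArg L h3

theorem dirDeriv_add {f h : H31 → E} (hf : IsSmooth f) (hh : IsSmooth h) (p : H31) (v : Amb) :
    dirDeriv (fun q => f q + h q) p v = dirDeriv f p v + dirDeriv h p v := by
  have := (differentiableAt_of_isSmooth hf p).hasFDerivAt.add
    (differentiableAt_of_isSmooth hh p).hasFDerivAt
  unfold dirDeriv
  erw [this.fderiv]
  rfl

theorem dirDeriv_smul {f : H31 → ℝ} {h : H31 → E} (hf : IsSmooth f) (hh : IsSmooth h) (p : H31)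
    (v : Amb) :
    dirDeriv (fun q => f q • h q) p v = f p • dirDeriv h p v + dirDeriv f p v • h p := by
  have := (differentiableAt_of_isSmooth hf p).hasFDerivAt.smul
    (differentiableAt_of_isSmooth hh p).hasFDerivAt
  unfold dirDeriv
  erw [this.fderiv]
  simp [retr_of_val]

theorem dirDeriv_const (c : E) (p : H31) (v : Amb) : dirDeriv (fun _ => c) p v = 0 := by
  simp [dirDeriv]

theorem dirDeriv_sub_vec (f : H31 → E) (p : H31) (v w : Amb) :
    dirDeriv f p (v - w) = dirDeriv f p v - dirDeriv f p w := map_sub _ _ _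

/-- The derivative of `q ↦ df_q(Y_q)`: the second derivative of `f` and the first one of `Y`. -/
theorem dirDeriv_dirDeriv {f : H31 → E} (hf : IsSmooth f) (Y : VF) (p : H31) {v : Amb}
    (hv : v ∈ TSpace p) :
    dirDeriv (fun q => dirDeriv f q (Y.1 q)) p v
      = fderiv ℝ (fderiv ℝ fun w => f (retr w)) p.val v (Y.1 p)
        + dirDeriv f p (dirDeriv Y.1 p v) := by
  have h1 : ContDiffOn ℝ ∞ (fderiv ℝ (fun w => f (retr w))) cone :=
    ContDiffOn.fderiv_of_isOpen hf isOpen_cone (by simp)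
  have h2 : HasFDerivAt (fderiv ℝ (fun w => f (retr w)))
      (fderiv ℝ (fderiv ℝ (fun w => f (retr w))) p.val) ((fun w => (retr w).val) p.val) := by
    simp only [retr_of_val]
    exact ((h1.differentiableOn (by simp)).differentiableAt
      (isOpen_cone.mem_nhds (val_mem_cone p))).hasFDerivAt
  have h3 := h2.comp p.val (differentiableAt_of_isSmooth isSmooth_val p).hasFDerivAt
  have h4 := h3.clm_apply (differentiableAt_of_isSmooth Y.2.1 p).hasFDerivAt
  have h5 := dirDeriv_val p hv
  unfold dirDeriv at h5 ⊢
  erw [h4.fderiv]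
  simp [retr_of_val, h5]
  exact add_comm _ _

/-- The second-derivative terms cancel by symmetry, so the ambient bracket is the commutator of
derivations. -/
theorem dirDeriv_bracket {f : H31 → E} (hf : IsSmooth f) (X Y : VF) (p : H31) :
    dirDeriv f p ((bracket X Y).1 p) = dirDeriv (fun q => dirDeriv f q (Y.1 q)) p (X.1 p)
      - dirDeriv (fun q => dirDeriv f q (X.1 q)) p (Y.1 p) := by
  have hs : IsSymmSndFDerivAt ℝ (fun w => f (retr w)) p.val :=
    (hf.contDiffAt (isOpen_cone.mem_nhds (val_mem_cone p))).isSymmSndFDerivAt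
      (by rw [minSmoothness_of_isRCLikeNormedField]; exact WithTop.coe_le_coe.2 le_top)
  rw [dirDeriv_dirDeriv hf Y p (X.2.2 p), dirDeriv_dirDeriv hf X p (Y.2.2 p),
    hs.eq (X.1 p) (Y.1 p)]
  change dirDeriv f p (dirDeriv Y.1 p (X.1 p) - dirDeriv X.1 p (Y.1 p)) = _
  rw [dirDeriv_sub_vec]
  abel

end Vector

/-! ### Derivations of smooth functions -/

theorem Fn.ext {f h : Fn} (H : ∀ p, f.1 p = h.1 p) : f = h := Subtype.ext (funext H)

theorem VF.ext {X Y : VF} (H : ∀ p, X.1 p = Y.1 p) : X = Y := Subtype.ext (funext H)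

theorem Fn.add_apply (f h : Fn) (p : H31) : (f + h).1 p = f.1 p + h.1 p := rfl

theorem Fn.sub_apply (f h : Fn) (p : H31) : (f - h).1 p = f.1 p - h.1 p := rfl

theorem Fn.neg_apply (f : Fn) (p : H31) : (-f).1 p = -f.1 p := rfl

theorem Fn.mul_apply (f h : Fn) (p : H31) : (f * h).1 p = f.1 p * h.1 p := rfl

theorem cst_apply (r : ℝ) (p : H31) : (cst r).1 p = r := rfl

theorem VF.smul_apply (f : Fn) (X : VF) (p : H31) : (f • X).1 p = f.1 p • X.1 p := rfl

/-- The derivative `X f` of a function along a vector field. -/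
def der (X : VF) (f : Fn) : Fn :=
  ⟨fun p => dirDeriv f.1 p (X.1 p), isSmooth_dirDeriv f.2 X.2.1⟩

theorem der_apply (X : VF) (f : Fn) (p : H31) : (der X f).1 p = dirDeriv f.1 p (X.1 p) := rfl

theorem der_add (X : VF) (f h : Fn) : der X (f + h) = der X f + der X h :=
  Fn.ext fun p => dirDeriv_add f.2 h.2 p _

theorem der_mul (X : VF) (f h : Fn) : der X (f * h) = f * der X h + der X f * h :=
  Fn.ext fun p => dirDeriv_smul (h := h.1) f.2 h.2 p _

theorem der_cst (X : VF) (r : ℝ) : der X (cst r) = 0 :=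
  Fn.ext fun p => dirDeriv_const r p _

theorem cst_zero : cst 0 = 0 := map_zero _

theorem cst_one : cst 1 = 1 := map_one _

theorem cst_neg (r : ℝ) : cst (-r) = -cst r := map_neg _ _

theorem cst_mul (r s : ℝ) : cst (r * s) = cst r * cst s := map_mul _ _ _

theorem cst_sub (r s : ℝ) : cst (r - s) = cst r - cst s := map_sub _ _ _

theorem der_zero (X : VF) : der X 0 = 0 := by
  have h := der_cst X 0
  rwa [cst_zero] at h

theorem der_neg (X : VF) (f : Fn) : der X (-f) = -der X f := by
  have h := der_mul X (cst (-1)) f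
  rw [der_cst, cst_neg, cst_one] at h
  simpa using h

theorem der_sub (X : VF) (f h : Fn) : der X (f - h) = der X f - der X h := by
  rw [sub_eq_add_neg, der_add, der_neg, sub_eq_add_neg]

theorem der_add_left (X Y : VF) (f : Fn) : der (X + Y) f = der X f + der Y f :=
  Fn.ext fun p => map_add (fderiv ℝ (fun w => f.1 (retr w)) p.val) (X.1 p) (Y.1 p)

theorem der_smul_left (h : Fn) (X : VF) (f : Fn) : der (h • X) f = h * der X f :=
  Fn.ext fun p => map_smul (fderiv ℝ (fun w => f.1 (retr w)) p.val) (h.1 p) (X.1 p)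

theorem der_bracket (X Y : VF) (f : Fn) :
    der (bracket X Y) f = der X (der Y f) - der Y (der X f) :=
  Fn.ext fun p => dirDeriv_bracket f.2 X Y p

/-! ### Components with respect to the left-invariant frame -/

/-- The workhorse of the tensor computations: an equation of vector fields becomes three equations
in the commutative ring `Fn`, accessible to `ring`. -/
theorem VF.ext_coframe {X Y : VF} (H0 : coframe 0 X = coframe 0 Y)
    (H1 : coframe 1 X = coframe 1 Y) (H2 : coframe 2 X = coframe 2 Y) : X = Y := by
  rw [frame_expansion X, frame_expansion Y]
  simp only [Fin.sum_univ_three, H0, H1, H2]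

/-- The vector field with given components. -/
def ofComp (f₀ f₁ f₂ : Fn) : VF := f₀ • frame 0 + f₁ • frame 1 + f₂ • frame 2

theorem ofComp_apply (f₀ f₁ f₂ : Fn) (p : H31) : (ofComp f₀ f₁ f₂).1 p
    = f₀.1 p • frameAt 0 p.val + f₁.1 p • frameAt 1 p.val + f₂.1 p • frameAt 2 p.val := rfl

theorem coframe_ofComp (f₀ f₁ f₂ : Fn) (i : Fin 3) :
    coframe i (ofComp f₀ f₁ f₂) = ![f₀, f₁, f₂] i := by
  simp only [ofComp, map_add, map_smul, coframe_frame, smul_eq_mul]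
  fin_cases i <;> simp

theorem coframe0_ofComp (f₀ f₁ f₂ : Fn) : coframe 0 (ofComp f₀ f₁ f₂) = f₀ :=
  coframe_ofComp f₀ f₁ f₂ 0

theorem coframe1_ofComp (f₀ f₁ f₂ : Fn) : coframe 1 (ofComp f₀ f₁ f₂) = f₁ :=
  coframe_ofComp f₀ f₁ f₂ 1

theorem coframe2_ofComp (f₀ f₁ f₂ : Fn) : coframe 2 (ofComp f₀ f₁ f₂) = f₂ :=
  coframe_ofComp f₀ f₁ f₂ 2

theorem coframe_apply (i : Fin 3) (X : VF) (p : H31) :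
    (coframe i X).1 p = coframeAt i p.val (X.1 p) := rfl

theorem frame_apply (i : Fin 3) (p : H31) : (frame i).1 p = frameAt i p.val := rfl

theorem expand_at (X : VF) (p : H31) : X.1 p = (coframe 0 X).1 p • frameAt 0 p.val
    + (coframe 1 X).1 p • frameAt 1 p.val + (coframe 2 X).1 p • frameAt 2 p.val := by
  conv_lhs => rw [frame_expansion X, Fin.sum_univ_three]
  rfl

/-- The frame fields, as linear maps of the ambient space. -/
def frameCLM (i : Fin 3) : Amb →L[ℝ] Amb :=
  LinearMap.toContinuousLinearMap
    { toFun := frameAt i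
      map_add' := by
        intro v w
        fin_cases i <;> simp [frameAt] <;> constructor <;> ring
      map_smul' := by
        intro c v
        fin_cases i <;> simp [frameAt] <;> constructor <;> ring }

theorem dirDeriv_frame (i : Fin 3) (X : VF) (p : H31) :
    dirDeriv (frame i).1 p (X.1 p) = frameAt i (X.1 p) :=
  dirDeriv_clm (frameCLM i) p (X.2.2 p)

/-- Ambient derivative of a vector field in terms of its components. -/
theorem dirDeriv_vectorField (X Y : VF) (p : H31) : dirDeriv Y.1 p (X.1 p)
    = ((der X (coframe 0 Y)).1 p • frameAt 0 p.val + (der X (coframe 1 Y)).1 p • frameAt 1 p.val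
        + (der X (coframe 2 Y)).1 p • frameAt 2 p.val)
      + ((coframe 0 Y).1 p • frameAt 0 (X.1 p) + (coframe 1 Y).1 p • frameAt 1 (X.1 p)
        + (coframe 2 Y).1 p • frameAt 2 (X.1 p)) := by
  have h : Y.1 = fun q => ((coframe 0 Y).1 q • (frame 0).1 q + (coframe 1 Y).1 q • (frame 1).1 q)
      + (coframe 2 Y).1 q • (frame 2).1 q := funext (expand_at Y)
  have s : ∀ i, IsSmooth fun q => (coframe i Y).1 q • (frame i).1 q :=
    fun i => (coframe i Y • frame i).2.1
  have s01 : IsSmooth fun q =>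
      (coframe 0 Y).1 q • (frame 0).1 q + (coframe 1 Y).1 q • (frame 1).1 q :=
    (coframe 0 Y • frame 0 + coframe 1 Y • frame 1).2.1
  have d : ∀ i, dirDeriv (fun q => (coframe i Y).1 q • (frame i).1 q) p (X.1 p)
      = (coframe i Y).1 p • frameAt i (X.1 p) + (der X (coframe i Y)).1 p • frameAt i p.val :=
    fun i => by
      rw [dirDeriv_smul (coframe i Y).2 (frame i).2.1, dirDeriv_frame]
      rfl
  rw [h, dirDeriv_add s01 (s 2), dirDeriv_add (s 0) (s 1), d, d, d]
  abel

/-- The frame fields are linear in the point, so the zeroth-order terms come from composing the maps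
`frameAt i`. The structure constants are `[X₀, X₁] = 2 X₂`, `[X₀, X₂] = -2 X₁`, `[X₁, X₂] = -2 X₀`.
-/
theorem bracket_eq (X Y : VF) : bracket X Y = ofComp
    (der X (coframe 0 Y) - der Y (coframe 0 X)
      - cst 2 * (coframe 1 X * coframe 2 Y - coframe 2 X * coframe 1 Y))
    (der X (coframe 1 Y) - der Y (coframe 1 X)
      - cst 2 * (coframe 0 X * coframe 2 Y - coframe 2 X * coframe 0 Y))
    (der X (coframe 2 Y) - der Y (coframe 2 X)
      + cst 2 * (coframe 0 X * coframe 1 Y - coframe 1 X * coframe 0 Y)) := by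
  apply VF.ext
  intro p
  change dirDeriv Y.1 p (X.1 p) - dirDeriv X.1 p (Y.1 p) = _
  rw [ofComp_apply, dirDeriv_vectorField, dirDeriv_vectorField, expand_at X p, expand_at Y p]
  simp only [Fn.add_apply, Fn.sub_apply, Fn.mul_apply, cst_apply]
  generalize p.val = w
  apply Prod.ext <;> apply Complex.ext <;> simp [frameAt] <;> ring

theorem coframe0_bracket (X Y : VF) : coframe 0 (bracket X Y)
    = der X (coframe 0 Y) - der Y (coframe 0 X)
      - cst 2 * (coframe 1 X * coframe 2 Y - coframe 2 X * coframe 1 Y) := by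
  rw [bracket_eq, coframe0_ofComp]

theorem coframe1_bracket (X Y : VF) : coframe 1 (bracket X Y)
    = der X (coframe 1 Y) - der Y (coframe 1 X)
      - cst 2 * (coframe 0 X * coframe 2 Y - coframe 2 X * coframe 0 Y) := by
  rw [bracket_eq, coframe1_ofComp]

theorem coframe2_bracket (X Y : VF) : coframe 2 (bracket X Y)
    = der X (coframe 2 Y) - der Y (coframe 2 X)
      + cst 2 * (coframe 0 X * coframe 1 Y - coframe 1 X * coframe 0 Y) := by
  rw [bracket_eq, coframe2_ofComp]


/-! ### The tensor fields in components -/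

theorem cst_two : cst 2 = 2 := map_ofNat (algebraMap ℝ Fn) 2

theorem cst_mul_cst_inv {r : ℝ} (h : r ≠ 0) : cst r * cst r⁻¹ = 1 := by
  rw [← cst_mul, mul_inv_cancel₀ h, cst_one]

theorem kkMetric_eq (lam : ℝ) (X Y : VF) : kkMetric lam (-lam) (-lam) X Y
    = cst lam * (coframe 0 X * coframe 0 Y - coframe 1 X * coframe 1 Y
      - coframe 2 X * coframe 2 Y) := by
  simp only [kkMetric, tensor, LinearMap.add_apply, LinearMap.smul_apply,
    LinearMap.smulRight_apply, smul_eq_mul, cst_neg]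
  ring

/-- Raising the index divides by `±lam`, so the tensor depends on `lam` and `t` only through `t /
-lam`. -/
theorem sLam_eq {lam : ℝ} (h : lam ≠ 0) (t : ℝ) (X Y : VF) : sLam lam (-lam) (-lam) t X Y
    = ofComp (coframe 2 X * coframe 1 Y - coframe 1 X * coframe 2 Y)
      (coframe 2 X * coframe 0 Y - cst (t / -lam) * coframe 0 X * coframe 2 Y)
      (cst (t / -lam) * coframe 0 X * coframe 1 Y - coframe 1 X * coframe 0 Y) := by
  have h1 := cst_mul_cst_inv h
  have h2 : cst (t / -lam) = -(cst t * cst lam⁻¹) := by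
    rw [← cst_mul, ← cst_neg, div_neg, div_eq_mul_inv]
  change ∑ i, (cst ((![lam, -lam, -lam] i)⁻¹) * sLamCov lam t X Y (frame i)) • frame i = _
  simp only [Fin.sum_univ_three, sLamCov, tensor3, wedge, tensor, LinearMap.add_apply,
    LinearMap.sub_apply, LinearMap.smul_apply, LinearMap.smulRight_apply, smul_eq_mul,
    coframe_frame, h2, Matrix.cons_val, inv_neg, cst_neg]
  unfold ofComp
  congr 1
  · congr 1
    · congr 1
      simp
      linear_combination (coframe 2 X * coframe 1 Y - coframe 1 X * coframe 2 Y) * h1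
    · congr 1
      simp
      linear_combination (coframe 2 X * coframe 0 Y) * h1
  · congr 1
    simp
    linear_combination (-coframe 1 X * coframe 0 Y) * h1

/-- The normalising square roots cancel since the two coefficients are equal and positive. -/
theorem phi0_eq {a : ℝ} (h : 0 < a) (X : VF) :
    phi0 a a X = ofComp 0 (coframe 2 X) (-coframe 1 X) := by
  have h1 := cst_mul_cst_inv (Real.sqrt_pos.2 h).ne'
  apply VF.ext_coframe <;>
    simp only [phi0, tensorVec, LinearMap.sub_apply, LinearMap.smulRight_apply,
      LinearMap.smul_apply, map_sub, map_smul, coframe_frame, coframe0_ofComp, coframe1_ofComp,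
      coframe2_ofComp, smul_eq_mul]
  · simp
  · simp
    linear_combination coframe 2 X * h1
  · simp
    linear_combination coframe 1 X * h1

/-! ### The Levi-Civita connection -/

/-- The Levi-Civita connection `∇_X Y = [X, Y] / 2` of the bi-invariant metric. -/
def lcConn : Connection where
  nabla X Y := ofComp
    (der X (coframe 0 Y) + (coframe 2 X * coframe 1 Y - coframe 1 X * coframe 2 Y))
    (der X (coframe 1 Y) + (coframe 2 X * coframe 0 Y - coframe 0 X * coframe 2 Y))
    (der X (coframe 2 Y) + (coframe 0 X * coframe 1 Y - coframe 1 X * coframe 0 Y))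
  add_left X X' Y := by
    apply VF.ext_coframe <;>
      simp only [map_add, coframe0_ofComp, coframe1_ofComp, coframe2_ofComp, der_add_left] <;> ring
  smul_left f X Y := by
    apply VF.ext_coframe <;>
      simp only [map_smul, coframe0_ofComp, coframe1_ofComp, coframe2_ofComp, der_smul_left,
        smul_eq_mul] <;> ring
  add_right X Y Y' := by
    apply VF.ext_coframe <;>
      simp only [map_add, coframe0_ofComp, coframe1_ofComp, coframe2_ofComp, der_add] <;> ring
  leibniz f X Y p := by
    -- The pointwise Leibniz rule is read as an identity of vector fields.
    refine congrArg (fun Z : VF => Z.1 p) (?_ : _ = f • ofComp _ _ _ + der X f • Y)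
    apply VF.ext_coframe <;>
      simp only [map_smul, map_add, coframe0_ofComp, coframe1_ofComp, coframe2_ofComp, der_mul,
        smul_eq_mul] <;> ring

theorem lcConn_nabla (X Y : VF) : lcConn.nabla X Y = ofComp
    (der X (coframe 0 Y) + (coframe 2 X * coframe 1 Y - coframe 1 X * coframe 2 Y))
    (der X (coframe 1 Y) + (coframe 2 X * coframe 0 Y - coframe 0 X * coframe 2 Y))
    (der X (coframe 2 Y) + (coframe 0 X * coframe 1 Y - coframe 1 X * coframe 0 Y)) := rfl

/-- Passes from the pointwise condition to an identity in `Fn`. -/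
theorem Connection.isMetric_iff (D : Connection) (g : Tensor2) : D.IsMetric g ↔
    ∀ X Y Z : VF, der X (g Y Z) = g (D.nabla X Y) Z + g Y (D.nabla X Z) :=
  ⟨fun h X Y Z => Fn.ext fun p => h X Y Z p,
    fun h X Y Z p => congrArg (fun f : Fn => f.1 p) (h X Y Z)⟩

/-- Compatibility is the skewness of `ad` for the bi-invariant form; torsion vanishes because the
zeroth-order part is half of the bracket. -/
theorem lcConn_isLeviCivita (lam : ℝ) : lcConn.IsLeviCivita (kkMetric lam (-lam) (-lam)) where
  metric := by
    rw [Connection.isMetric_iff]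
    intro X Y Z
    simp only [kkMetric_eq, lcConn_nabla, coframe0_ofComp, coframe1_ofComp, coframe2_ofComp,
      der_sub, der_mul, der_cst]
    ring
  torsionFree X Y := by
    apply VF.ext_coframe <;>
      simp only [map_sub, lcConn_nabla, coframe0_ofComp, coframe1_ofComp, coframe2_ofComp,
        coframe0_bracket, coframe1_bracket, coframe2_bracket, cst_two] <;> ring

/-- The metric is non-degenerate. -/
theorem eq_of_kkMetric_eq {lam : ℝ} (h : lam ≠ 0) {X Y : VF}
    (H : ∀ Z, kkMetric lam (-lam) (-lam) X Z = kkMetric lam (-lam) (-lam) Y Z) : X = Y := by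
  have h1 := cst_mul_cst_inv h
  have e : ∀ f g : Fn, cst lam * f = cst lam * g → f = g := fun f g hfg => by
    linear_combination cst lam⁻¹ * hfg - (f - g) * h1
  have H0 := H (frame 0)
  have H1 := H (frame 1)
  have H2 := H (frame 2)
  simp only [kkMetric_eq, coframe_frame] at H0 H1 H2
  apply VF.ext_coframe <;> apply e
  · simpa using H0
  · simpa using H1
  · simpa using H2

/-- Uniqueness of the Levi-Civita connection. -/
theorem leviCivita_unique {lam : ℝ} (h : lam ≠ 0) {D D' : Connection}
    (hD : D.IsLeviCivita (kkMetric lam (-lam) (-lam)))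
    (hD' : D'.IsLeviCivita (kkMetric lam (-lam) (-lam))) : D = D' := by
  have hs : ∀ X Y, kkMetric lam (-lam) (-lam) X Y = kkMetric lam (-lam) (-lam) Y X := by
    intro X Y
    simp only [kkMetric_eq]
    ring
  -- The difference of the two connections with its index lowered. It is symmetric in the first two
  -- arguments (no torsion) and skew in the last two (metric).
  set b : VF → VF → VF → Fn := fun X Y Z =>
    kkMetric lam (-lam) (-lam) (D.nabla X Y - D'.nabla X Y) Z with hb
  have b1 : ∀ X Y Z, b X Y Z = b Y X Z := by
    intro X Y Z
    have h1 := hD.torsionFree X Y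
    rw [← hD'.torsionFree X Y] at h1
    simp only [hb]
    congr 2
    rw [sub_eq_sub_iff_add_eq_add] at h1 ⊢
    rw [h1, add_comm]
  have b2 : ∀ X Y Z, b X Y Z = -b X Z Y := by
    intro X Y Z
    have h1 := (Connection.isMetric_iff _ _).1 hD.metric X Y Z
    rw [(Connection.isMetric_iff _ _).1 hD'.metric X Y Z] at h1
    simp only [hb, map_sub, LinearMap.sub_apply]
    rw [hs _ Y, hs _ Y]
    linear_combination -h1
  have b3 : ∀ X Y Z, b X Y Z = 0 := by
    intro X Y Z
    have h2 : cst 2 * b X Y Z = 0 := by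
      rw [cst_two]
      -- Alternating the two symmetries six times returns to the original order with a minus sign,
      -- so `b = -b`.
      linear_combination b2 X Y Z - b1 X Z Y - b2 Z X Y + b1 Z Y X + b2 Y Z X - b1 Y X Z
    linear_combination cst 2⁻¹ * h2 - b X Y Z * cst_mul_cst_inv (two_ne_zero (α := ℝ))
  apply Connection.ext
  funext X Y
  apply eq_of_kkMetric_eq h
  intro Z
  have := b3 X Y Z
  simp only [hb, map_sub, LinearMap.sub_apply] at this
  exact sub_eq_zero.1 this

/-- The frame spans the tangent spaces. -/
theorem frameAt_expansion {p : H31} {v : Amb} (hv : v ∈ TSpace p) :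
    v = coframeAt 0 p.val v • frameAt 0 p.val + coframeAt 1 p.val v • frameAt 1 p.val
      + coframeAt 2 p.val v • frameAt 2 p.val := by
  have hp := p.quad_val
  have ht : bil p.val v = 0 := hv
  rw [bil_eq] at ht
  simp only [quad, Complex.normSq_apply] at hp
  generalize p.val = w at *
  apply Prod.ext <;> apply Complex.ext <;> simp [coframeAt, frameAt]
  · linear_combination (-v.1.re) * hp + w.1.re * ht
  · linear_combination (-v.1.im) * hp + w.1.im * ht
  · linear_combination (-v.2.re) * hp + w.2.re * ht
  · linear_combination (-v.2.im) * hp + w.2.im * ht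

theorem kkMetric_isLorentzian {lam : ℝ} (h : lam < 0) :
    IsLorentzian (kkMetric lam (-lam) (-lam)) where
  symm X Y := by
    simp only [kkMetric_eq]
    ring
  signature p := by
    have hs : 0 < Real.sqrt (-lam) := Real.sqrt_pos.2 (neg_pos.2 h)
    have hq : Real.sqrt (-lam) ^ 2 = -lam := Real.sq_sqrt (neg_pos.2 h).le
    -- All three frame vectors have squared length `±lam`, so one factor normalises them; index `0`
    -- is the timelike one.
    refine ⟨fun i => cst (Real.sqrt (-lam))⁻¹ • frame i, ?_, ?_⟩
    · have e : lam = -(Real.sqrt (-lam) * Real.sqrt (-lam)) := by linarith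
      have e' : lam * ((Real.sqrt (-lam))⁻¹ * (Real.sqrt (-lam))⁻¹) = -1 := by
        rw [← mul_inv]
        nth_rw 1 [e]
        rw [neg_mul, mul_inv_cancel₀ (mul_pos hs hs).ne']
      intro i j
      rw [kkMetric_eq]
      simp only [map_smul, coframe_frame, smul_eq_mul, Fn.mul_apply, Fn.sub_apply, cst_apply]
      fin_cases i <;> fin_cases j <;> simp [Fn.one_apply, Fn.zero_apply] <;> linarith
    · apply le_antisymm
      · rw [Submodule.span_le]
        rintro _ ⟨i, rfl⟩
        exact (cst (Real.sqrt (-lam))⁻¹ • frame i).2.2 p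
      · intro v hv
        have m : ∀ i, frameAt i p.val ∈ Submodule.span ℝ
            (Set.range fun i => (cst (Real.sqrt (-lam))⁻¹ • frame i : VF).1 p) := by
          intro i
          have := Submodule.smul_mem _ (Real.sqrt (-lam)) (Submodule.subset_span (R := ℝ)
            (Set.mem_range_self (f := fun i => (cst (Real.sqrt (-lam))⁻¹ • frame i : VF).1 p) i))
          have e : (Real.sqrt (-lam)) • (cst (Real.sqrt (-lam))⁻¹ • frame i : VF).1 p
              = frameAt i p.val := by
            rw [VF.smul_apply, cst_apply, smul_smul, mul_inv_cancel₀ hs.ne', one_smul]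
            rfl
          rwa [e] at this
        rw [frameAt_expansion hv]
        exact add_mem (add_mem (Submodule.smul_mem _ _ (m 0)) (Submodule.smul_mem _ _ (m 1)))
          (Submodule.smul_mem _ _ (m 2))

/-! ### The contact structure -/

theorem coframe_xi0 (lam : ℝ) (i : Fin 3) :
    coframe i (xi0 lam) = cst (Real.sqrt |lam|)⁻¹ * if i = 0 then 1 else 0 := by
  rw [xi0, map_smul, coframe_frame, smul_eq_mul]

theorem eta0_eq (lam : ℝ) (X : VF) : eta0 lam X = cst (Real.sqrt |lam|) * coframe 0 X := rfl

/-- Trades `lam` for a square, so that identities mixing `lam` with `√|lam|` follow from the single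
relation `√|lam| * (√|lam|)⁻¹ = 1`. -/
theorem cst_lam_eq {lam : ℝ} (h : lam < 0) :
    cst lam = -(cst (Real.sqrt |lam|) * cst (Real.sqrt |lam|)) := by
  rw [← cst_mul, ← cst_neg, Real.mul_self_sqrt (abs_nonneg _), abs_of_neg h, neg_neg]

theorem cst_sqrt_ne {lam : ℝ} (h : lam < 0) : Real.sqrt |lam| ≠ 0 :=
  (Real.sqrt_pos.2 (abs_pos.2 h.ne)).ne'

theorem kkMetric_xi0 {lam : ℝ} (h : lam < 0) :
    kkMetric lam (-lam) (-lam) (xi0 lam) (xi0 lam) = -1 := by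
  have h1 := cst_mul_cst_inv (cst_sqrt_ne h)
  simp only [kkMetric_eq, coframe_xi0, cst_lam_eq h]
  simp
  linear_combination (cst (Real.sqrt |lam|) * cst (Real.sqrt |lam|)⁻¹ + 1) * h1

theorem isAlmostContactMetric {lam : ℝ} (h : lam < 0) :
    IsAlmostContactMetric (kkMetric lam (-lam) (-lam)) (phi0 (-lam) (-lam)) (xi0 lam)
      (eta0 lam) where
  sq X := by
    have h1 := cst_mul_cst_inv (cst_sqrt_ne h)
    apply VF.ext_coframe <;>
      simp only [phi0_eq (neg_pos.2 h), map_add, map_neg, map_smul, coframe0_ofComp,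
        coframe1_ofComp, coframe2_ofComp, coframe_xi0, eta0_eq, smul_eq_mul] <;> simp
    linear_combination -coframe 0 X * h1
  eta_xi := by
    rw [eta0_eq, coframe_xi0, if_pos rfl, mul_one, cst_mul_cst_inv (cst_sqrt_ne h)]
  unit := Or.inr (kkMetric_xi0 h)
  compat X Y := by
    rw [kkMetric_xi0 h]
    simp only [kkMetric_eq, phi0_eq (neg_pos.2 h), eta0_eq, coframe0_ofComp, coframe1_ofComp,
      coframe2_ofComp, cst_lam_eq h]
    ring

/-- The `X₀`-part of `∇` commutes with `φ₀`, so only the `X₁, X₂` directions contribute. On the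
right, `lam` from the metric cancels the two factors `1 / √|lam|` from `alpha` and `ξ₀` up to sign.
-/
theorem isAlphaSasakian {lam : ℝ} (h : lam < 0) :
    IsAlphaSasakian (cst (1 / Real.sqrt (-lam))) (kkMetric lam (-lam) (-lam)) lcConn
      (phi0 (-lam) (-lam)) (xi0 lam) (eta0 lam) where
  almostContact := isAlmostContactMetric h
  nabla_phi X Y := by
    have h1 := cst_mul_cst_inv (cst_sqrt_ne h)
    rw [kkMetric_xi0 h, one_div]
    apply VF.ext_coframe <;>
      simp only [phi0_eq (neg_pos.2 h), lcConn_nabla, kkMetric_eq, map_sub, map_smul,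
        coframe0_ofComp, coframe1_ofComp, coframe2_ofComp, coframe_xi0, eta0_eq, smul_eq_mul,
        cst_lam_eq h, der_zero, der_neg] <;> rw [← abs_of_neg h] <;> simp
    · linear_combination (-(coframe 1 X * coframe 1 Y + coframe 2 X * coframe 2 Y)
        * (cst (Real.sqrt |lam|) * cst (Real.sqrt |lam|)⁻¹ + 1)) * h1
        + coframe 0 X * coframe 0 Y
          * (cst (Real.sqrt |lam|) * cst (Real.sqrt |lam|)⁻¹) * h1
    · linear_combination -(coframe 1 X * coframe 0 Y) * h1
    · linear_combination -(coframe 2 X * coframe 0 Y) * h1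

/-! ### The connection `∇ - S` -/

/-- `S` agrees with `[X, Y] / 2` except in its `θ⁰ ⊗ J` part, where it has weight `t / -lam` instead
of `1`. -/
theorem subTensor_nabla {lam : ℝ} (h : lam ≠ 0) (t : ℝ) (X Y : VF) :
    (lcConn.subTensor (sLam lam (-lam) (-lam) t)).nabla X Y = ofComp (der X (coframe 0 Y))
      (der X (coframe 1 Y) - cst (1 - t / -lam) * coframe 0 X * coframe 2 Y)
      (der X (coframe 2 Y) + cst (1 - t / -lam) * coframe 0 X * coframe 1 Y) := by
  change lcConn.nabla X Y - sLam lam (-lam) (-lam) t X Y = _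
  rw [sLam_eq h, lcConn_nabla, cst_sub, cst_one]
  apply VF.ext_coframe <;>
    simp only [map_sub, coframe0_ofComp, coframe1_ofComp, coframe2_ofComp] <;> ring

/-- This is `R(X, Y)Z = -[[X, Y], Z] / 4` on left-invariant fields; `u₀, u₁, u₂` are the components
of `[X, Y] / 2`. All derivatives drop out by `der_bracket`. -/
theorem lcConn_curv (X Y Z : VF) : lcConn.curv X Y Z =
    let u₀ := coframe 2 X * coframe 1 Y - coframe 1 X * coframe 2 Y
    let u₁ := coframe 2 X * coframe 0 Y - coframe 0 X * coframe 2 Y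
    let u₂ := coframe 0 X * coframe 1 Y - coframe 1 X * coframe 0 Y
    ofComp (u₁ * coframe 2 Z - u₂ * coframe 1 Z) (u₀ * coframe 2 Z - u₂ * coframe 0 Z)
      (u₁ * coframe 0 Z - u₀ * coframe 1 Z) := by
  unfold Connection.curv
  apply VF.ext_coframe <;>
    simp only [map_sub, lcConn_nabla, coframe0_ofComp, coframe1_ofComp, coframe2_ofComp,
      coframe0_bracket, coframe1_bracket, coframe2_bracket, cst_two, der_add, der_sub, der_mul,
      der_bracket] <;> ring

/-- The connection form takes values in the abelian algebra `ℝ J`, so only its exterior derivative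
survives; the factor `2` is `dθ⁰(X₁, X₂)`. -/
theorem subTensor_curv {lam : ℝ} (h : lam ≠ 0) (t : ℝ) (X Y Z : VF) :
    (lcConn.subTensor (sLam lam (-lam) (-lam) t)).curv X Y Z =
    let k := cst (1 - t / -lam) * 2 * (coframe 1 X * coframe 2 Y - coframe 2 X * coframe 1 Y)
    ofComp 0 (-(k * coframe 2 Z)) (k * coframe 1 Z) := by
  unfold Connection.curv
  apply VF.ext_coframe <;>
    simp only [map_sub, subTensor_nabla h, coframe0_ofComp, coframe1_ofComp, coframe2_ofComp,
      coframe0_bracket, cst_two, der_add, der_sub, der_mul, der_cst, der_bracket] <;> ring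

/-- In the frame, `g`, `R` and `S` have constant coefficients that are annihilated by the rotation
`J`, which is the only zeroth-order part of `∇ - S`. -/
theorem isHomogeneousStructure {lam : ℝ} (h : lam ≠ 0) (t : ℝ) :
    IsHomogeneousStructure (kkMetric lam (-lam) (-lam)) lcConn (sLam lam (-lam) (-lam) t) where
  metric := by
    rw [Connection.isMetric_iff]
    intro X Y Z
    simp only [kkMetric_eq, subTensor_nabla h, coframe0_ofComp, coframe1_ofComp,
      coframe2_ofComp, der_sub, der_mul, der_cst]
    ring
  curvature W X Y Z := by
    apply VF.ext_coframe <;>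
      simp only [map_add, subTensor_nabla h, lcConn_curv, coframe0_ofComp, coframe1_ofComp,
        coframe2_ofComp, der_sub, der_mul] <;> ring
  self W X Y := by
    apply VF.ext_coframe <;>
      simp only [map_add, subTensor_nabla h, sLam_eq h, coframe0_ofComp, coframe1_ofComp,
        coframe2_ofComp, der_sub, der_mul, der_cst] <;> ring

theorem isHomogeneousAlmostContact {lam : ℝ} (h : lam < 0) (t : ℝ) :
    IsHomogeneousAlmostContact (kkMetric lam (-lam) (-lam)) lcConn (sLam lam (-lam) (-lam) t)
      (phi0 (-lam) (-lam)) (xi0 lam) (eta0 lam) where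
  almostContact := isAlmostContactMetric h
  homogeneous := isHomogeneousStructure h.ne t
  phi_parallel X Y := by
    apply VF.ext_coframe <;>
      simp only [subTensor_nabla h.ne, phi0_eq (neg_pos.2 h), coframe0_ofComp, coframe1_ofComp,
        coframe2_ofComp, der_zero, der_neg] <;> ring
  xi_parallel X := by
    apply VF.ext_coframe <;>
      simp [subTensor_nabla h.ne, coframe_xi0, coframe0_ofComp, coframe1_ofComp,
        coframe2_ofComp, der_zero, der_cst]
  eta_parallel X Y p := by
    refine congrArg (fun f : Fn => f.1 p)
      (?_ : der X (eta0 lam Y) = eta0 lam ((lcConn.subTensor _).nabla X Y))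
    simp only [eta0_eq, subTensor_nabla h.ne, coframe0_ofComp, der_mul, der_cst]
    ring


/-! ### Maps of the hypersurface which rotate the frame -/

/-- The first row of `!![a, b; *, *] * mat w * diag(1, e)`, up to conjugation. -/
def rotLin (a b e : ℂ) : Amb →L[ℝ] Amb :=
  LinearMap.toContinuousLinearMap
    { toFun := fun w => (a * w.1 + b * conj w.2, e * (a * w.2 + b * conj w.1))
      map_add' := by
        intro v w
        apply Prod.ext <;> simp <;> ring
      map_smul' := by
        intro c v
        apply Prod.ext <;> simp <;> ring }

theorem rotLin_apply (a b e : ℂ) (w : Amb) :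
    rotLin a b e w = (a * w.1 + b * conj w.2, e * (a * w.2 + b * conj w.1)) := rfl

/-- `F` is the restriction of a linear map which preserves `X₀` and rotates `X₁, X₂` by the
constant unit complex number `e`. -/
structure FrameRotation (F : H31 → H31) (a b e : ℂ) : Prop where
  unit : e.re ^ 2 + e.im ^ 2 = 1
  val : ∀ p, (F p).val = rotLin a b e p.val

theorem coframeAt_comb (p : H31) (y : Fin 3 → ℝ) (i : Fin 3) :
    coframeAt i p.val (y 0 • frameAt 0 p.val + y 1 • frameAt 1 p.val + y 2 • frameAt 2 p.val)
      = y i := by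
  have h := congrArg (fun f : Fn => f.1 p)
    (coframe_ofComp (cst (y 0)) (cst (y 1)) (cst (y 2)) i)
  refine Eq.trans h ?_
  fin_cases i <;> rfl

theorem VF.eq_at_iff (X : VF) (p : H31) (y : Fin 3 → ℝ) :
    y 0 • frameAt 0 p.val + y 1 • frameAt 1 p.val + y 2 • frameAt 2 p.val = X.1 p
      ↔ ∀ i, (coframe i X).1 p = y i := by
  constructor
  · intro h i
    rw [coframe_apply, ← h, coframeAt_comb]
  · intro h
    rw [expand_at X p, h, h, h]

section Rotation

variable {F : H31 → H31} {a b e : ℂ}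

theorem FrameRotation.isSmooth (hF : FrameRotation F a b e) : IsSmooth fun p => (F p).val := by
  simp only [hF.val]
  exact isSmooth_clm _

/-- The differential of a restricted linear map is that map, so being related turns into a condition
on components: the first is carried over and the other two are rotated by `e`. -/
theorem FrameRotation.related_iff (hF : FrameRotation F a b e) (X X' : VF) :
    Related F X X' ↔ ∀ p, (coframe 0 X').1 (F p) = (coframe 0 X).1 p
      ∧ (coframe 1 X').1 (F p) = e.re * (coframe 1 X).1 p - e.im * (coframe 2 X).1 p
      ∧ (coframe 2 X').1 (F p) = e.im * (coframe 1 X).1 p + e.re * (coframe 2 X).1 p := by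
  refine forall_congr' fun p => ?_
  have h1 : dirDeriv (fun q => (F q).val) p (X.1 p) = rotLin a b e (X.1 p) := by
    simp only [hF.val]
    exact dirDeriv_clm _ p (X.2.2 p)
  have hv := hF.val p
  have h2 : rotLin a b e (X.1 p) = (coframe 0 X).1 p • frameAt 0 (F p).val
      + (e.re * (coframe 1 X).1 p - e.im * (coframe 2 X).1 p) • frameAt 1 (F p).val
      + (e.im * (coframe 1 X).1 p + e.re * (coframe 2 X).1 p) • frameAt 2 (F p).val := by
    conv_lhs => rw [expand_at X p]
    rw [hv]
    generalize p.val = w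
    have hu := hF.unit
    generalize (coframe 0 X).1 p = x₀
    generalize (coframe 1 X).1 p = x₁
    generalize (coframe 2 X).1 p = x₂
    simp only [rotLin_apply, frameAt]
    -- The first coordinate of the frame at `F p` carries `conj e`-type factors against `e`, so it
    -- needs `|e| = 1`; the second does not.
    apply Prod.ext <;> apply Complex.ext <;> simp
    · linear_combination (-(x₁ * (a.re * w.2.re - a.im * w.2.im + (b.re * w.1.re + b.im * w.1.im))
        + x₂ * (a.re * w.2.im + a.im * w.2.re + (b.im * w.1.re - b.re * w.1.im)))) * hu
    · linear_combination (-(x₁ * (a.re * w.2.im + a.im * w.2.re + (b.im * w.1.re - b.re * w.1.im))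
        - x₂ * (a.re * w.2.re - a.im * w.2.im + (b.re * w.1.re + b.im * w.1.im)))) * hu
    · ring
    · ring
  rw [h1, h2]
  refine (VF.eq_at_iff X' (F p) ![_, _, _]).trans ?_
  rw [Fin.forall_fin_succ, Fin.forall_fin_two]
  rfl

theorem FrameRotation.der_apply (hF : FrameRotation F a b e) {X X' : VF} (h : Related F X X')
    {f f' : Fn} (hf : ∀ p, f'.1 (F p) = f.1 p) (p : H31) :
    (der X' f').1 (F p) = (der X f).1 p := by
  have h1 : (fun q => f'.1 (F q)) = f.1 := funext hf
  change dirDeriv f'.1 (F p) (X'.1 (F p)) = dirDeriv f.1 p (X.1 p)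
  rw [← h1, dirDeriv_comp hF.isSmooth f'.2, h p]

theorem FrameRotation.metric (hF : FrameRotation F a b e) (lam : ℝ) {X Y X' Y' : VF}
    (hX : Related F X X') (hY : Related F Y Y') (p : H31) :
    (kkMetric lam (-lam) (-lam) X' Y').1 (F p) = (kkMetric lam (-lam) (-lam) X Y).1 p := by
  obtain ⟨x0, x1, x2⟩ := (hF.related_iff X X').1 hX p
  obtain ⟨y0, y1, y2⟩ := (hF.related_iff Y Y').1 hY p
  simp only [kkMetric_eq, Fn.mul_apply, Fn.sub_apply, cst_apply, x0, x1, x2, y0, y1, y2]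
  linear_combination (-lam * ((coframe 1 X).1 p * (coframe 1 Y).1 p
    + (coframe 2 X).1 p * (coframe 2 Y).1 p)) * hF.unit

theorem FrameRotation.preservesContact (hF : FrameRotation F a b e) {lam : ℝ} (h : lam < 0)
    (t : ℝ) : PreservesContact F (sLam lam (-lam) (-lam) t) (phi0 (-lam) (-lam)) (xi0 lam)
      (eta0 lam) where
  tensor X Y X' Y' hX hY := by
    rw [hF.related_iff] at *
    intro p
    obtain ⟨x0, x1, x2⟩ := hX p
    obtain ⟨y0, y1, y2⟩ := hY p
    simp only [sLam_eq h.ne, coframe0_ofComp, coframe1_ofComp, coframe2_ofComp, Fn.mul_apply,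
      Fn.sub_apply, cst_apply, x0, x1, x2, y0, y1, y2]
    refine ⟨?_, by ring, by ring⟩
    linear_combination ((coframe 2 X).1 p * (coframe 1 Y).1 p
      - (coframe 1 X).1 p * (coframe 2 Y).1 p) * hF.unit
  endo X X' hX := by
    rw [hF.related_iff] at *
    intro p
    obtain ⟨x0, x1, x2⟩ := hX p
    simp only [phi0_eq (neg_pos.2 h), coframe0_ofComp, coframe1_ofComp, coframe2_ofComp,
      Fn.neg_apply, Fn.zero_apply, x1, x2]
    refine ⟨trivial, by ring, by ring⟩
  reeb := by
    rw [hF.related_iff]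
    intro p
    simp [coframe_xi0, Fn.zero_apply, cst_apply]
  form X X' hX p := by
    have x0 := ((hF.related_iff X X').1 hX p).1
    simp only [eta0_eq, Fn.mul_apply, cst_apply, x0]

/-- The rotation is constant, so it passes through derivatives, and plane rotations commute with
`J`. -/
theorem FrameRotation.preservesConnection (hF : FrameRotation F a b e) {lam : ℝ} (h : lam ≠ 0)
    (t : ℝ) : PreservesConnection F (lcConn.subTensor (sLam lam (-lam) (-lam) t)) := by
  intro X Y X' Y' hX hY
  have hX' := (hF.related_iff X X').1 hX
  have hY' := (hF.related_iff Y Y').1 hY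
  rw [hF.related_iff]
  intro p
  obtain ⟨x0, x1, x2⟩ := hX' p
  obtain ⟨y0, y1, y2⟩ := hY' p
  have d0 := hF.der_apply hX (f := coframe 0 Y) (fun q => (hY' q).1) p
  -- Pulled back by `F`, the components of `Y'` are constant-coefficient combinations of those of
  -- `Y`.
  have d1 := hF.der_apply hX (f := cst e.re * coframe 1 Y - cst e.im * coframe 2 Y)
    (fun q => (hY' q).2.1) p
  have d2 := hF.der_apply hX (f := cst e.im * coframe 1 Y + cst e.re * coframe 2 Y)
    (fun q => (hY' q).2.2) p
  simp only [der_add, der_sub, der_mul, der_cst, Fn.add_apply, Fn.sub_apply, Fn.mul_apply,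
    Fn.zero_apply, cst_apply] at d1 d2
  simp only [subTensor_nabla h, coframe0_ofComp, coframe1_ofComp, coframe2_ofComp,
    Fn.add_apply, Fn.sub_apply, Fn.mul_apply, cst_apply, x0, y1, y2, d0, d1, d2]
  refine ⟨trivial, by ring, by ring⟩

end Rotation

section Action

variable {G : Type*} [Group G] [MulAction G H31]

/-- The smooth inverse required of a diffeomorphism is the action of `x⁻¹`, itself a frame rotation.
-/
theorem isIsometry_of_frameRotation
    (H : ∀ x : G, ∃ a b e, FrameRotation (fun p => x • p) a b e) (lam : ℝ) (x : G) :
    IsIsometry (kkMetric lam (-lam) (-lam)) (fun p => x • p) := by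
  obtain ⟨a, b, e, h⟩ := H x
  obtain ⟨a', b', e', h'⟩ := H x⁻¹
  exact ⟨⟨h.isSmooth, fun p => x⁻¹ • p, h'.isSmooth, inv_smul_smul x, smul_inv_smul x⟩,
    fun X Y X' Y' hX hY p => h.metric lam hX hY p⟩

end Action

/-! ### The actions of `SU(1,1)`, `SU(1,1) × U(1)` and `U(1,1)` -/

theorem SU11_smul_val (A : SU11) (p : H31) : (A • p).val
    = (A.1.val 0 0 * p.val.1 + A.1.val 0 1 * conj p.val.2,
      A.1.val 0 0 * p.val.2 + A.1.val 0 1 * conj p.val.1) := by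
  change ((A.1.val * mat p.val) 0 0, (A.1.val * mat p.val) 0 1) = _
  simp [mat, Matrix.mul_apply, Fin.sum_univ_two]

theorem U11_smul_val (B : U11) (p : H31) : (B • p).val
    = (B.1.val 0 0 * p.val.1 + B.1.val 0 1 * conj p.val.2,
      B.1.val.det⁻¹ * (B.1.val 0 0 * p.val.2 + B.1.val 0 1 * conj p.val.1)) := by
  change ((B.1.val * mat p.val * detRot B.1.val.det) 0 0,
    (B.1.val * mat p.val * detRot B.1.val.det) 0 1) = _
  simp [mat, detRot, Matrix.mul_apply, Fin.sum_univ_two]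
  ring

theorem mat_SU11_smul (A : SU11) (p : H31) : mat (A • p).val = A.1.val * mat p.val :=
  mat_ofMat _ (IsSU.mul A.2 (IsSU.mat p))

theorem mat_U11_smul (B : U11) (p : H31) :
    mat (B • p).val = B.1.val * mat p.val * detRot B.1.val.det :=
  mat_ofMat _ (IsU.isSU_mul B.2 p)

theorem mat_SU11xCircle_smul (x : SU11 × Circle) (p : H31) :
    mat (x • p).val = x.1.1.val * mat p.val * rot x.2 :=
  mat_ofMat _ (IsSU.mul (IsSU.mul x.1.2 (IsSU.mat p)) (isSU_rot x.2))

theorem SU11_frameRotation (A : SU11) :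
    FrameRotation (fun p => A • p) (A.1.val 0 0) (A.1.val 0 1) 1 :=
  ⟨by simp, fun p => by rw [SU11_smul_val, rotLin_apply, one_mul]⟩

theorem U11_frameRotation (B : U11) :
    FrameRotation (fun p => B • p) (B.1.val 0 0) (B.1.val 0 1) B.1.val.det⁻¹ := by
  refine ⟨?_, U11_smul_val B⟩
  have h := IsU.det_mul_conj B.2
  have h1 : Complex.normSq B.1.val.det = 1 := by
    have := Complex.normSq_eq_conj_mul_self (z := B.1.val.det)
    rw [h] at this
    exact_mod_cast this
  have h2 : Complex.normSq B.1.val.det⁻¹ = 1 := by rw [map_inv₀, h1, inv_one]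
  rw [Complex.normSq_apply] at h2
  linear_combination h2

theorem toU11_val (x : SU11 × Circle) : (toU11 x).1.val = (x.2 : ℂ)⁻¹ • x.1.1.val := rfl

theorem toU11_det (x : SU11 × Circle) : (toU11 x).1.val.det = ((x.2 : ℂ)⁻¹) ^ 2 := by
  rw [toU11_val, Matrix.det_smul, x.1.2.2, mul_one, Fintype.card_fin]

/-- Since `det (u⁻¹ A) = u⁻²`, the right factors agree: `u⁻¹ diag(1, u²) = diag(u⁻¹, u)`. -/
theorem smul_eq_toU11_smul (x : SU11 × Circle) (p : H31) : x • p = toU11 x • p := by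
  apply H31.ext_mat
  have hu := x.2.coe_ne_zero
  rw [mat_SU11xCircle_smul, mat_U11_smul, toU11_det, toU11_val]
  simp only [Matrix.smul_mul, Matrix.mul_assoc]
  rw [← Matrix.mul_smul, ← Matrix.mul_smul]
  congr 2
  ext i j
  fin_cases i <;> fin_cases j <;> simp [rot, detRot] <;> field_simp

theorem SU11xCircle_frameRotation (x : SU11 × Circle) :
    ∃ a b e, FrameRotation (fun p => x • p) a b e := by
  simp only [smul_eq_toU11_smul]
  exact ⟨_, _, _, U11_frameRotation _⟩

/-- The element of `SU(1,1)` given by a point of the hypersurface. -/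
def pointSU (p : H31) : SU11 :=
  ⟨Matrix.GeneralLinearGroup.mkOfDetNeZero (mat p.val)
    (by rw [(IsSU.mat p).2]; exact one_ne_zero), IsSU.mat p⟩

theorem mat_base : mat base.val = 1 := by
  ext i j
  fin_cases i <;> fin_cases j <;> simp [mat, base]

theorem pointSU_smul_base (p : H31) : pointSU p • base = p := by
  apply H31.ext_mat
  rw [mat_SU11_smul, mat_base, Matrix.mul_one]
  rfl

theorem SU11_isPretransitive : MulAction.IsPretransitive SU11 H31 :=
  MulAction.IsPretransitive.of_orbit (x₀ := base) fun p => ⟨pointSU p, pointSU_smul_base p⟩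

theorem SU11xCircle_isPretransitive : MulAction.IsPretransitive (SU11 × Circle) H31 := by
  refine MulAction.IsPretransitive.of_orbit (x₀ := base) fun p => ⟨(pointSU p, 1), ?_⟩
  apply H31.ext_mat
  rw [mat_SU11xCircle_smul, mat_base]
  have h : rot 1 = 1 := by
    ext i j; fin_cases i <;> fin_cases j <;> simp [rot]
  rw [h, Matrix.mul_one, Matrix.mul_one]
  rfl

theorem U11_isPretransitive : MulAction.IsPretransitive U11 H31 :=
  MulAction.IsPretransitive.of_orbit (x₀ := base) fun p => by
    obtain ⟨x, hx⟩ := SU11xCircle_isPretransitive.exists_smul_eq base p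
    exact ⟨toU11 x, by rw [← smul_eq_toU11_smul, hx]⟩

/-! ### Isotropy groups, effectiveness and the covering homomorphism -/

theorem SU11_ext {A B : SU11} (h : A.1.val = B.1.val) : A = B := Subtype.ext (Units.ext h)

theorem U11_ext {A B : U11} (h : A.1.val = B.1.val) : A = B := Subtype.ext (Units.ext h)

/-- The orbit map at the base point is the identification of points with matrices, so the action is
simply transitive. -/
theorem SU11_smul_base_iff (A : SU11) : A • base = base ↔ A.1.val = 1 := by
  constructor
  · intro h
    have := mat_SU11_smul A base
    rwa [h, mat_base, Matrix.mul_one, eq_comm] at this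
  · intro h
    rw [show A = 1 from SU11_ext h, one_smul]

theorem SU11_faithfulSMul : FaithfulSMul SU11 H31 := ⟨fun {A B} h => by
  have h1 : (B⁻¹ * A) • base = base := by rw [mul_smul, h, inv_smul_smul]
  have h2 : B⁻¹ * A = 1 := SU11_ext ((SU11_smul_base_iff _).1 h1)
  exact (inv_mul_eq_one.1 h2).symm⟩

/-- The isotropy group of the base point in `U(1,1)`. -/
theorem U11_smul_base_iff (B : U11) :
    B • base = base ↔ ∃ u : ℂ, B.1.val = !![1, 0; 0, u] := by
  constructor
  · intro h
    have h1 := U11_smul_val B base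
    rw [h] at h1
    have hd : B.1.val.det ≠ 0 := fun h0 => by
      have := IsU.det_mul_conj B.2
      simp [h0] at this
    simp [base] at h1
    obtain ⟨h2, h3⟩ := h1
    -- The image of the base point is `(B₀₀, det B⁻¹ * B₀₁)`. With `B₀₀ = 1` and `B₀₁ = 0`, the
    -- `(0,0)` entry of the unitarity relation then kills `B₁₀`.
    have h4 : B.1.val 0 1 = 0 := by simpa [hd] using h3.symm
    have hu : IsU B.1.val := B.2
    have h5 := congrFun (congrFun hu 0) 1
    have h6 := congrFun (congrFun hu 1) 1
    have h7 := congrFun (congrFun hu 0) 0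
    simp [Matrix.mul_apply, Fin.sum_univ_two, herm, h4, ← h2] at h5 h6 h7
    refine ⟨B.1.val 1 1, ?_⟩
    ext i j
    fin_cases i <;> fin_cases j <;> simp [h4, ← h2, h7]
  · rintro ⟨u, hu⟩
    apply H31.ext
    rw [U11_smul_val, hu]
    simp [base]


/-- A point of the hypersurface off the orbit of the base point under the diagonal matrices. -/
def offPoint : H31 := ⟨(Real.sqrt 2, 1), by
  have h : Real.sqrt 2 * Real.sqrt 2 = 2 := Real.mul_self_sqrt (by norm_num)
  simp [quad, Complex.normSq_apply, h]
  norm_num⟩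

/-- An element fixing the base point is `diag(1, u)` and multiplies `z₂` by `u⁻¹`; a fixed point
with `z₂ ≠ 0` gives `u = 1`. -/
theorem U11_eq_one {B : U11} (h : ∀ p : H31, B • p = p) : B = 1 := by
  obtain ⟨u, hu⟩ := (U11_smul_base_iff B).1 (h base)
  have h1 := congrArg (fun p : H31 => p.val.2) (h offPoint)
  simp only [U11_smul_val, hu] at h1
  simp [offPoint] at h1
  apply U11_ext
  rw [hu, h1]
  ext i j
  fin_cases i <;> fin_cases j <;> simp

theorem U11_faithfulSMul : FaithfulSMul U11 H31 := ⟨fun {A B} h => by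
  have h2 : B⁻¹ * A = 1 := U11_eq_one fun p => by rw [mul_smul, h, inv_smul_smul]
  exact (inv_mul_eq_one.1 h2).symm⟩

theorem toU11_eq_one {x : SU11 × Circle} (h : toU11 x = 1) :
    x.1.1.val = (x.2 : ℂ) • (1 : Mat) ∧ ((x.2 : ℂ) = 1 ∨ (x.2 : ℂ) = -1) := by
  have h1 := toU11_val x
  rw [h] at h1
  have h2 : x.1.1.val = (x.2 : ℂ) • (1 : Mat) := by
    have h3 := congrArg (fun M : Mat => (x.2 : ℂ) • M) h1
    simp only [smul_smul, mul_inv_cancel₀ x.2.coe_ne_zero, one_smul] at h3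
    exact h3.symm
  refine ⟨h2, mul_self_eq_one_iff.1 ?_⟩
  have h3 := x.1.2.2
  rw [h2, Matrix.det_smul, Matrix.det_one, mul_one, Fintype.card_fin] at h3
  rw [← sq, h3]

/-- In the kernel `A` is the scalar `u` and has determinant one, so `u = ±1`; the second factor
determines the element. -/
theorem finite_ker_toU11 : (toU11.ker : Set (SU11 × Circle)).Finite := by
  refine Set.Finite.of_finite_image (f := fun x => (x.2 : ℂ))
    ((Set.toFinite {1, -1}).subset ?_) ?_
  · rintro _ ⟨x, hx, rfl⟩
    exact (toU11_eq_one hx).2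
  · intro x hx y hy hxy
    have h2 : x.2 = y.2 := Subtype.ext hxy
    refine Prod.ext (SU11_ext ?_) h2
    rw [(toU11_eq_one hx).1, (toU11_eq_one hy).1, h2]

/-- The action factors through the faithful action of `U(1,1)`, so its kernel lies in a finite
group, and a finite Hausdorff space is discrete. -/
theorem discreteTopology_ker :
    DiscreteTopology (MulAction.toPermHom (SU11 × Circle) H31).ker := by
  have h : (MulAction.toPermHom (SU11 × Circle) H31).ker ≤ toU11.ker := by
    intro x hx
    refine U11_eq_one fun p => ?_
    rw [← smul_eq_toU11_smul]
    exact congrArg (fun f : Equiv.Perm H31 => f p) hx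
  have : Finite (MulAction.toPermHom (SU11 × Circle) H31).ker :=
    (finite_ker_toU11.subset h).to_subtype
  infer_instance

theorem IsU.smul {M : Mat} (h : IsU M) {c : ℂ} (hc : conj c * c = 1) : IsU (c • M) := by
  unfold IsU at *
  rw [Matrix.conjTranspose_smul, Matrix.smul_mul, Matrix.smul_mul, Matrix.mul_smul, h, smul_smul]
  change (conj c * c) • herm = herm
  rw [hc, one_smul]

theorem toU11_surjective : Function.Surjective toU11 := by
  intro B
  have hd := IsU.det_mul_conj B.2
  set d := B.1.val.det with hdef
  have hn : ‖d‖ = 1 := by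
    have h2 : ‖d‖ * ‖d‖ = 1 := by
      have := congrArg norm hd
      rwa [norm_mul, Complex.norm_conj, norm_one] at this
    nlinarith [norm_nonneg d]
  -- A square root of `(det B)⁻¹`, so that `u B` has determinant one.
  set u : Circle := Circle.exp (-(d.arg / 2)) with hu
  have hud : (u : ℂ) ^ 2 * d = 1 := by
    have h1 : d = Complex.exp (d.arg * Complex.I) := by
      conv_lhs => rw [← Complex.norm_mul_exp_arg_mul_I d, hn]
      simp
    conv_lhs => rw [h1]
    rw [hu, Circle.coe_exp, ← Complex.exp_nat_mul, ← Complex.exp_add]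
    convert Complex.exp_zero using 2
    push_cast
    ring
  have hdet : ((u : ℂ) • B.1.val).det = 1 := by
    rw [Matrix.det_smul, Fintype.card_fin]
    exact hud
  have huc : conj (u : ℂ) * u = 1 := by
    rw [← Circle.coe_inv_eq_conj, Circle.coe_inv, inv_mul_cancel₀ u.coe_ne_zero]
  refine ⟨(⟨Matrix.GeneralLinearGroup.mkOfDetNeZero ((u : ℂ) • B.1.val)
    (by rw [hdet]; exact one_ne_zero), IsU.smul B.2 huc, hdet⟩, u), ?_⟩
  apply U11_ext
  rw [toU11_val]
  change (u : ℂ)⁻¹ • ((u : ℂ) • B.1.val) = _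
  rw [smul_smul, inv_mul_cancel₀ u.coe_ne_zero, one_smul]

/-! ### The Lie algebras -/

theorem expGL_val (Y : Mat) : (expGL Y).val = NormedSpace.exp Y := rfl

open scoped Matrix.Norms.Operator in
theorem hasDerivAt_expGL (Y : Mat) (i j : Fin 2) :
    HasDerivAt (fun s : ℝ => (expGL (s • Y)).val i j) (Y i j) 0 := by
  have h := hasDerivAt_exp_smul_const (𝕂 := ℝ) Y 0
  rw [zero_smul, NormedSpace.exp_zero, one_mul] at h
  exact (LinearMap.toContinuousLinearMap
    (Matrix.entryLinearMap ℝ ℂ i j)).hasFDerivAt.comp_hasDerivAt (0 : ℝ) h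

theorem expGL_zero_smul (Y : Mat) : (expGL ((0 : ℝ) • Y)).val = 1 := by
  rw [expGL_val, zero_smul, NormedSpace.exp_zero]

/-- The hypothesis says `N = K (-M) K⁻¹`, hence `exp N = K (exp M)⁻¹ K⁻¹`. It turns infinitesimal
invariance of a form `K` into invariance under the exponential. -/
theorem exp_mul_eq_of_mul_eq {K M N : Mat} (hK : IsUnit K) (h : N * K = -(K * M)) :
    NormedSpace.exp N * K * NormedSpace.exp M = K := by
  have hd : IsUnit K.det := (Matrix.isUnit_iff_isUnit_det _).1 hK
  have h1 : N = K * (-M) * K⁻¹ := by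
    rw [Matrix.mul_neg, ← h, Matrix.mul_assoc, Matrix.mul_nonsing_inv _ hd, Matrix.mul_one]
  have hM : IsUnit (NormedSpace.exp M).det :=
    (Matrix.isUnit_iff_isUnit_det _).1 (Matrix.isUnit_exp M)
  rw [h1, Matrix.exp_conj _ _ hK, Matrix.exp_neg]
  simp only [Matrix.mul_assoc]
  rw [← Matrix.mul_assoc K⁻¹, Matrix.nonsing_inv_mul _ hd, Matrix.one_mul,
    Matrix.nonsing_inv_mul _ hM, Matrix.mul_one]

theorem isUnit_herm : IsUnit herm :=
  (Matrix.isUnit_iff_isUnit_det _).2 (by simp [herm])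

theorem isU_exp {Y : Mat} (h : Y.conjTranspose * herm = -(herm * Y)) : IsU (NormedSpace.exp Y) := by
  unfold IsU
  rw [← Matrix.exp_conjTranspose]
  exact exp_mul_eq_of_mul_eq isUnit_herm h

/-- For `2 × 2` matrices trace zero means infinitesimal invariance of the symplectic form, and the
determinant is the factor by which that form is scaled. -/
theorem det_exp_eq_one {Y : Mat} (h : Y 0 0 + Y 1 1 = 0) : (NormedSpace.exp Y).det = 1 := by
  have h1 : Y.transpose * !![0, 1; -1, 0] = -(!![0, 1; -1, 0] * Y) := by
    rw [Matrix.eta_fin_two Y]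
    ext i j
    fin_cases i <;> fin_cases j <;> simp [Matrix.mul_apply, Fin.sum_univ_two]
    · linear_combination h
    · linear_combination -h
  have h2 := exp_mul_eq_of_mul_eq ((Matrix.isUnit_iff_isUnit_det _).2 (by simp)) h1
  rw [Matrix.exp_transpose] at h2
  have h3 := congrFun (congrFun h2 0) 1
  simp [Matrix.mul_apply, Fin.sum_univ_two] at h3
  rw [Matrix.det_fin_two]
  linear_combination h3

/-- The elements of `u(1,1)`. -/
def uMat (α β : ℝ) (z : ℂ) : Mat := !![Complex.I * α, z; conj z, Complex.I * β]

theorem smul_uMat (s α β : ℝ) (z : ℂ) : s • uMat α β z = uMat (s * α) (s * β) (s * z) := by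
  ext i j
  fin_cases i <;> fin_cases j <;> simp [uMat] <;> ring

theorem isU_exp_uMat (α β : ℝ) (z : ℂ) : IsU (NormedSpace.exp (uMat α β z)) := by
  apply isU_exp
  ext i j
  fin_cases i <;> fin_cases j <;>
    simp [uMat, herm, Matrix.mul_apply, Fin.sum_univ_two, Matrix.conjTranspose_apply]

theorem hasDerivAt_conj {f : ℝ → ℂ} {f' : ℂ} {s : ℝ} (h : HasDerivAt f f' s) :
    HasDerivAt (fun r => conj (f r)) (conj f') s :=
  (Complex.conjCLE : ℂ →L[ℝ] ℂ).hasFDerivAt.comp_hasDerivAt s h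

theorem eq_I_mul_im {z : ℂ} (h : conj z + z = 0) : z = Complex.I * (z.im : ℝ) := by
  have h1 := congrArg Complex.re h
  simp at h1
  apply Complex.ext <;> simp
  linarith

/-- Differentiating the entries of the relation `M* herm M = herm` along `exp(sY)` at `s = 0` gives
the linear equations of `u(1,1)`. -/
theorem eq_uMat_of_isU {Y : Mat} (h : ∀ s : ℝ, IsU (expGL (s • Y)).val) :
    Y = uMat (Y 0 0).im (Y 1 1).im (Y 0 1) := by
  have d := hasDerivAt_expGL Y
  have e := expGL_zero_smul Y
  have key : ∀ i j, conj (Y 0 i) * (1 : Mat) 0 j + conj ((1 : Mat) 0 i) * Y 0 j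
      - (conj (Y 1 i) * (1 : Mat) 1 j + conj ((1 : Mat) 1 i) * Y 1 j) = 0 := by
    intro i j
    have h1 := ((hasDerivAt_conj (d 0 i)).mul (d 0 j)).sub ((hasDerivAt_conj (d 1 i)).mul (d 1 j))
    rw [e] at h1
    refine h1.unique ?_
    refine (hasDerivAt_const (0 : ℝ) (herm i j)).congr_of_eventuallyEq
      (Filter.Eventually.of_forall fun s => ?_)
    have h2 := congrFun (congrFun (h s) i) j
    simp [Matrix.mul_apply, Fin.sum_univ_two, herm, Matrix.conjTranspose_apply] at h2 ⊢
    rw [← h2]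
    ring
  have k00 := key 0 0
  have k01 := key 0 1
  have k11 := key 1 1
  simp at k00 k01 k11
  have h10 : Y 1 0 = conj (Y 0 1) := by
    have := congrArg conj k01
    simp at this
    linear_combination -this
  have h11 : Y 1 1 = Complex.I * ((Y 1 1).im : ℝ) := eq_I_mul_im (by linear_combination -k11)
  ext i j
  fin_cases i <;> fin_cases j <;> simp only [uMat]
  · exact eq_I_mul_im k00
  · rfl
  · exact h10
  · exact h11

theorem hasDerivAt_det_expGL (Y : Mat) :
    HasDerivAt (fun s : ℝ => (expGL (s • Y)).val.det) (Y 0 0 + Y 1 1) 0 := by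
  have d := hasDerivAt_expGL Y
  have e := expGL_zero_smul Y
  have h1 := ((d 0 0).mul (d 1 1)).sub ((d 0 1).mul (d 1 0))
  rw [e] at h1
  simp only [Matrix.det_fin_two]
  refine h1.congr_deriv ?_
  simp

theorem mem_lieAlg_U11 {Y : Mat} : Y ∈ lieAlg U11 ↔ ∃ α β z, Y = uMat α β z := by
  constructor
  · intro h
    exact ⟨_, _, _, eq_uMat_of_isU h⟩
  · rintro ⟨α, β, z, rfl⟩ s
    rw [smul_uMat]
    exact isU_exp_uMat _ _ _

theorem uMat_inj {α β α' β' : ℝ} {z z' : ℂ} (h : uMat α β z = uMat α' β' z') :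
    α = α' ∧ β = β' ∧ z = z' := by
  have h0 := congrFun (congrFun h 0) 0
  have h1 := congrFun (congrFun h 0) 1
  have h2 := congrFun (congrFun h 1) 1
  simp [uMat] at h0 h1 h2
  exact ⟨h0, h2, h1⟩

/-- The determinant is constantly one along the curve, so its derivative, the trace, vanishes. -/
theorem mem_lieAlg_SU11 {Y : Mat} : Y ∈ lieAlg SU11 ↔ ∃ α z, Y = uMat α (-α) z := by
  constructor
  · intro h
    have h1 := eq_uMat_of_isU fun s => (h s).1
    have h2 : Y 0 0 + Y 1 1 = 0 := by
      refine (hasDerivAt_det_expGL Y).unique ?_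
      refine (hasDerivAt_const (0 : ℝ) (1 : ℂ)).congr_of_eventuallyEq
        (Filter.Eventually.of_forall fun s => (h s).2)
    have h3 : (Y 1 1).im = -(Y 0 0).im := by
      have := congrArg Complex.im h2
      simp at this
      linarith
    rw [h3] at h1
    exact ⟨_, _, h1⟩
  · rintro ⟨α, z, rfl⟩ s
    rw [smul_uMat]
    refine ⟨isU_exp_uMat _ _ _, det_exp_eq_one ?_⟩
    simp [uMat]

/-! ### Fundamental vector fields -/

/-- The fundamental vector fields as linear maps of the ambient space. -/
def killLin (α β : ℝ) (z : ℂ) : Amb →L[ℝ] Amb :=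
  LinearMap.toContinuousLinearMap
    { toFun := fun w => (Complex.I * α * w.1 + z * conj w.2, -(Complex.I * β) * w.2 + z * conj w.1)
      map_add' := by
        intro v w
        apply Prod.ext <;> simp <;> ring
      map_smul' := by
        intro c v
        apply Prod.ext <;> simp <;> ring }

theorem killLin_apply (α β : ℝ) (z : ℂ) (w : Amb) : killLin α β z w
    = (Complex.I * α * w.1 + z * conj w.2, -(Complex.I * β) * w.2 + z * conj w.1) := rfl

/-- The fundamental vector field generated by `uMat α β z`. -/
def killing (α β : ℝ) (z : ℂ) : VF :=
  ⟨fun p => killLin α β z p.val, isSmooth_clm _, by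
    intro p
    change bil _ _ = 0
    rw [bil_eq]
    simp [killLin_apply]
    ring⟩

theorem killing_apply (α β : ℝ) (z : ℂ) (p : H31) :
    (killing α β z).1 p = killLin α β z p.val := rfl

theorem hasDerivAt_prodMk {f g : ℝ → ℂ} {f' g' : ℂ} {s : ℝ} (hf : HasDerivAt f f' s)
    (hg : HasDerivAt g g' s) : HasDerivAt (fun r => ((f r, g r) : Amb)) (f', g') s :=
  hf.prodMk hg

/-- The factor `det⁻¹` contributes `-(iα + iβ)`, which turns the coefficient `iα` of the second
coordinate into `-iβ`. Uniqueness of derivatives gives the converse. -/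
theorem isFundamental_U11_iff {α β : ℝ} {z : ℂ} {X : VF} :
    IsFundamental U11 (uMat α β z) X ↔ X = killing α β z := by
  have hY : uMat α β z ∈ lieAlg U11 := mem_lieAlg_U11.2 ⟨_, _, _, rfl⟩
  have key : ∀ p : H31, HasDerivAt
      (fun s : ℝ => ((⟨expGL (s • uMat α β z), hY s⟩ : U11) • p).val) ((killing α β z).1 p) 0 := by
    intro p
    have d := hasDerivAt_expGL (uMat α β z)
    have e := expGL_zero_smul (uMat α β z)
    have dd := hasDerivAt_det_expGL (uMat α β z)
    simp only [U11_smul_val]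
    refine (hasDerivAt_prodMk (((d 0 0).mul_const _).add ((d 0 1).mul_const _))
      ((dd.fun_inv (by rw [e, Matrix.det_one]; exact one_ne_zero)).mul
        (((d 0 0).mul_const _).add ((d 0 1).mul_const _)))).congr_deriv ?_
    simp only [Pi.add_apply, e]
    simp [killing_apply, killLin_apply, uMat]
    ring
  constructor
  · rintro ⟨hY', h⟩
    exact VF.ext fun p => (h p).unique (key p)
  · rintro rfl
    exact ⟨hY, key⟩

/-- The definition includes membership in the Lie algebra, and this forces `β = -α`. -/
theorem isFundamental_SU11_iff {α β : ℝ} {z : ℂ} {X : VF} :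
    IsFundamental SU11 (uMat α β z) X ↔ β = -α ∧ X = killing α β z := by
  have key : ∀ hY : uMat α (-α) z ∈ lieAlg SU11, ∀ p : H31, HasDerivAt
      (fun s : ℝ => ((⟨expGL (s • uMat α (-α) z), hY s⟩ : SU11) • p).val)
      ((killing α (-α) z).1 p) 0 := by
    intro hY p
    have d := hasDerivAt_expGL (uMat α (-α) z)
    simp only [SU11_smul_val]
    refine (hasDerivAt_prodMk (((d 0 0).mul_const _).add ((d 0 1).mul_const _))
      (((d 0 0).mul_const _).add ((d 0 1).mul_const _))).congr_deriv ?_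
    simp [killing_apply, killLin_apply, uMat]
  constructor
  · rintro ⟨hY, h⟩
    obtain ⟨α', z', h'⟩ := mem_lieAlg_SU11.1 hY
    obtain ⟨rfl, rfl, rfl⟩ := uMat_inj h'
    exact ⟨rfl, VF.ext fun p => (h p).unique (key hY p)⟩
  · rintro ⟨rfl, rfl⟩
    have hY : uMat α (-α) z ∈ lieAlg SU11 := mem_lieAlg_SU11.2 ⟨_, _, rfl⟩
    exact ⟨hY, key hY⟩


/-! ### The reductive decompositions -/

theorem mem_hSub {Y : Mat} : Y ∈ hSub ↔ ∃ β, Y = uMat 0 β 0 := by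
  have h : ∀ β : ℝ, β • !![0, 0; 0, Complex.I] = uMat 0 β 0 := by
    intro β
    ext i j
    fin_cases i <;> fin_cases j <;> simp [uMat, mul_comm]
  rw [hSub, Submodule.mem_span_singleton]
  simp only [h, eq_comm]

theorem mem_mSub {lam t : ℝ} {Y : Mat} :
    Y ∈ mSub lam t ↔ ∃ α z, Y = uMat α (-(t / -lam) * α) z := by
  have h : ∀ a b c : ℝ, a • !![Complex.I, 0; 0, -Complex.I * ((t / -lam : ℝ) : ℂ)]
      + (b • !![0, 1; 1, 0] + c • !![0, Complex.I; -Complex.I, 0])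
      = uMat a (-(t / -lam) * a) (b + c * Complex.I) := by
    intro a b c
    generalize t / -lam = τ
    ext i j
    fin_cases i <;> fin_cases j <;> simp [uMat] <;> ring
  rw [mSub, Submodule.mem_span_triple]
  simp only [add_assoc, h]
  constructor
  · rintro ⟨a, b, c, rfl⟩
    exact ⟨_, _, rfl⟩
  · rintro ⟨α, z, rfl⟩
    exact ⟨α, z.re, z.im, by rw [Complex.re_add_im]⟩

/-- Lets the `SU(1,1)` case reuse the results on `mSub` at `t = -lam`. -/
theorem su11_eq {lam : ℝ} (h : lam ≠ 0) : su11 = mSub lam (-lam) := by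
  have h1 : -lam / -lam = 1 := div_self (neg_ne_zero.2 h)
  rw [su11, mSub, h1]
  congr 1
  ext Y
  simp [pauli]
  tauto

theorem mem_map_stabilizer {G : Subgroup (Matrix.GeneralLinearGroup (Fin 2) ℂ)}
    [MulAction G H31] {A : Matrix.GeneralLinearGroup (Fin 2) ℂ} :
    A ∈ (MulAction.stabilizer G base).map G.subtype ↔ ∃ h : A ∈ G, (⟨A, h⟩ : G) • base = base := by
  constructor
  · rintro ⟨x, hx, rfl⟩
    exact ⟨x.2, hx⟩
  · rintro ⟨h, hx⟩
    exact ⟨⟨A, h⟩, hx, rfl⟩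

theorem expGL_diag (s β : ℝ) :
    (expGL (s • uMat 0 β 0)).val = !![1, 0; 0, Complex.exp (Complex.I * (s * β))] := by
  have h : s • uMat 0 β 0 = Matrix.diagonal ![0, Complex.I * (s * β)] := by
    ext i j
    fin_cases i <;> fin_cases j <;> simp [uMat]
    ring
  rw [expGL_val, h, Matrix.exp_diagonal]
  ext i j
  fin_cases i <;> fin_cases j <;> simp [Pi.coe_exp, Complex.exp_eq_exp_ℂ]

theorem U11_isotropy : lieAlg ((MulAction.stabilizer U11 base).map U11.subtype) = hSub := by
  ext Y
  rw [SetLike.mem_coe, mem_hSub]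
  constructor
  · intro h
    have h1 : ∀ s, ∃ u : ℂ, (expGL (s • Y)).val = !![1, 0; 0, u] := fun s => by
      obtain ⟨hs, hb⟩ := mem_map_stabilizer.1 (h s)
      exact (U11_smul_base_iff _).1 hb
    have h2 := eq_uMat_of_isU fun s => (mem_map_stabilizer.1 (h s)).choose
    have h3 : ∀ j, Y 0 j = 0 := fun j => by
      refine (hasDerivAt_expGL Y 0 j).unique
        ((hasDerivAt_const (0 : ℝ) ((1 : Mat) 0 j)).congr_of_eventuallyEq
          (Filter.Eventually.of_forall fun s => ?_))
      obtain ⟨u, hu⟩ := h1 s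
      have e : ∀ j, (!![1, 0; 0, u] : Mat) 0 j = (1 : Mat) 0 j := by simp [Fin.forall_fin_two]
      exact (congrFun (congrFun hu 0) j).trans (e j)
    rw [h3, h3] at h2
    exact ⟨_, h2⟩
  · rintro ⟨β, rfl⟩ s
    have hY : uMat 0 β 0 ∈ lieAlg U11 := mem_lieAlg_U11.2 ⟨_, _, _, rfl⟩
    exact mem_map_stabilizer.2 ⟨hY s, (U11_smul_base_iff _).2 ⟨_, expGL_diag s β⟩⟩

theorem U11_isReductiveDecomposition (lam t : ℝ) :
    IsReductiveDecomposition U11 hSub (mSub lam t) where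
  isotropy := U11_isotropy
  sum := by
    ext Y
    rw [mem_lieAlg_U11, SetLike.mem_coe, Submodule.mem_sup]
    have h : ∀ α β β' z, uMat 0 β 0 + uMat α β' z = uMat α (β + β') z := by
      intro α β β' z
      ext i j
      fin_cases i <;> fin_cases j <;> simp [uMat]
      ring
    constructor
    · rintro ⟨α, β, z, rfl⟩
      -- The `m`-part is determined by the first row; the isotropy part absorbs what remains in the
      -- lower right corner.
      refine ⟨_, mem_hSub.2 ⟨β + t / -lam * α, rfl⟩, _, mem_mSub.2 ⟨α, z, rfl⟩, ?_⟩
      rw [h]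
      congr 1
      ring
    · rintro ⟨_, hy, _, hz, rfl⟩
      obtain ⟨β, rfl⟩ := mem_hSub.1 hy
      obtain ⟨α, z, rfl⟩ := mem_mSub.1 hz
      exact ⟨_, _, _, h _ _ _ _⟩
  disjoint := by
    rw [Submodule.disjoint_def]
    intro Y hy hz
    obtain ⟨β, rfl⟩ := mem_hSub.1 hy
    obtain ⟨α, z, h⟩ := mem_mSub.1 hz
    obtain ⟨rfl, rfl, rfl⟩ := uMat_inj h
    ext i j
    fin_cases i <;> fin_cases j <;> simp [uMat]
  ad_invariant k hk Y hY := by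
    obtain ⟨α, z, rfl⟩ := mem_mSub.1 hY
    obtain ⟨u, hu⟩ := (U11_smul_base_iff k).1 hk
    obtain ⟨u', hu'⟩ := (U11_smul_base_iff k⁻¹).1 (inv_mem (s := MulAction.stabilizer U11 base) hk)
    have h1 : u * u' = 1 := by
      have h2 : k.1.val * (k⁻¹).1.val = 1 := k.1.mul_inv
      rw [hu, hu'] at h2
      simpa using congrFun (congrFun h2 1) 1
    have h2 := IsU.det_mul_conj (M := k.1.val) k.2
    rw [hu] at h2
    simp at h2
    have h3 : conj u' = u := by
      have h4 : conj u * conj u' = 1 := by rw [← map_mul, h1, map_one]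
      linear_combination u * h4 - conj u' * h2
    rw [hu, hu']
    -- Conjugation by `diag(1, u)` fixes the diagonal and rotates the off-diagonal entry by `u⁻¹`.
    refine mem_mSub.2 ⟨α, z * u', ?_⟩
    ext i j
    fin_cases i <;> fin_cases j <;> simp [uMat, h3]
    · ring
    · linear_combination (Complex.I * (t / -lam * α)) * h1

theorem SU11_isReductiveDecomposition {lam : ℝ} (h : lam ≠ 0) :
    IsReductiveDecomposition SU11 ⊥ (mSub lam (-lam)) where
  isotropy := by
    ext Y
    constructor
    · intro hY
      have h1 : ∀ s, (expGL (s • Y)).val = 1 := fun s => by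
        obtain ⟨hs, hb⟩ := mem_map_stabilizer.1 (hY s)
        exact (SU11_smul_base_iff _).1 hb
      ext i j
      refine (hasDerivAt_expGL Y i j).unique
        ((hasDerivAt_const (0 : ℝ) ((1 : Mat) i j)).congr_of_eventuallyEq
          (Filter.Eventually.of_forall fun s => congrFun (congrFun (h1 s) i) j))
    · intro hY s
      have h0 : Y = 0 := hY
      have h1 : expGL (s • Y) = 1 := Units.ext (by
        rw [expGL_val, h0, smul_zero, NormedSpace.exp_zero]
        rfl)
      rw [h1]
      exact one_mem _
  sum := by
    ext Y
    rw [mem_lieAlg_SU11, SetLike.mem_coe, bot_sup_eq, mem_mSub, div_self (neg_ne_zero.2 h)]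
    simp only [neg_mul, one_mul]
  disjoint := disjoint_bot_left
  ad_invariant k hk Y hY := by
    have h1 : k = 1 := SU11_ext ((SU11_smul_base_iff k).1 hk)
    rw [h1]
    simpa using hY

/-! ### The canonical connection -/

theorem coframeAt_base (i : Fin 3) (v : Amb) :
    coframeAt i base.val v = ![v.1.im, v.2.re, v.2.im] i := by
  fin_cases i <;> simp [coframeAt, base]

theorem ofComp_base (f₀ f₁ f₂ : Fn) : (ofComp f₀ f₁ f₂).1 base
    = (Complex.I * f₀.1 base, f₁.1 base + Complex.I * f₂.1 base) := by
  rw [ofComp_apply]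
  apply Prod.ext <;> simp [frameAt, base, mul_comm]

/-- The value of `∇_X Y - S_X Y` at the base point for fundamental vector fields. -/
theorem subTensor_nabla_killing {lam : ℝ} (h : lam ≠ 0) (t α β α' β' : ℝ) (z z' : ℂ) :
    ((lcConn.subTensor (sLam lam (-lam) (-lam) t)).nabla (killing α β z)
      (killing α' β' z')).1 base = (z' * conj z - z * conj z',
        -Complex.I * β' * z + Complex.I * α' * z - (1 + ((t / -lam : ℝ) : ℂ)) * Complex.I * α * z') := by
  -- The ambient derivative of `killing α' β' z'` is computed twice: through frame components, and
  -- directly because the field is linear. Comparing the two gives the unknown derivatives of the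
  -- components at the base point.
  have h1 := dirDeriv_vectorField (killing α β z) (killing α' β' z') base
  have h2 : dirDeriv (killing α' β' z').1 base ((killing α β z).1 base)
      = killLin α' β' z' ((killing α β z).1 base) :=
    dirDeriv_clm (killLin α' β' z') base ((killing α β z).2.2 base)
  rw [h2] at h1
  have h3 : (killing α β z).1 base = (Complex.I * α, z) := by
    simp [killing_apply, killLin_apply, base]
  have h3' : (killing α' β' z').1 base = (Complex.I * α', z') := by
    simp [killing_apply, killLin_apply, base]
  rw [subTensor_nabla h, ofComp_base]
  simp only [Fn.sub_apply, Fn.add_apply, Fn.mul_apply, cst_apply]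
  generalize (der (killing α β z) (coframe 0 (killing α' β' z'))).1 base = d₀ at *
  generalize (der (killing α β z) (coframe 1 (killing α' β' z'))).1 base = d₁ at *
  generalize (der (killing α β z) (coframe 2 (killing α' β' z'))).1 base = d₂ at *
  generalize t / -lam = τ
  simp only [coframe_apply, coframeAt_base, h3, h3', killLin_apply, frameAt] at h1 ⊢
  have e1 := congrArg Prod.fst h1
  have e2 := congrArg Prod.snd h1
  simp [base] at e1 e2
  have r1 := congrArg Complex.re e1
  have r2 := congrArg Complex.im e1
  have r3 := congrArg Complex.re e2
  have r4 := congrArg Complex.im e2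
  simp at r1 r2 r3 r4
  apply Prod.ext <;> apply Complex.ext <;> simp
  · ring
  · linear_combination -r2
  · linear_combination -r3
  · linear_combination -r4

/-- Stated for any isotropy algebra `k ≤ hSub`, so that it serves both `hSub` and `⊥`. -/
theorem isCanonicalConnection {G : Subgroup (Matrix.GeneralLinearGroup (Fin 2) ℂ)}
    [MulAction G H31] (hrot : ∀ x : G, ∃ a b e, FrameRotation (fun p => x • p) a b e)
    (hstar : ∀ Y ∈ lieAlg G, IsFundamental G Y (killing (Y 0 0).im (Y 1 1).im (Y 0 1)))
    {lam : ℝ} (h : lam ≠ 0) (t : ℝ) {k : Submodule ℝ Mat} (hk : k ≤ hSub) :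
    IsCanonicalConnection G k (mSub lam t) (lcConn.subTensor (sLam lam (-lam) (-lam) t)) := by
  refine ⟨fun x => ?_, fun Y => killing (Y 0 0).im (Y 1 1).im (Y 0 1), hstar, ?_⟩
  · obtain ⟨a, b, e, hx⟩ := hrot x
    exact hx.preservesConnection h t
  · intro X hX Y hY Z hZ hXYZ
    obtain ⟨α, z, rfl⟩ := mem_mSub.1 hX
    obtain ⟨α', z', rfl⟩ := mem_mSub.1 hY
    obtain ⟨γ, ζ, rfl⟩ := mem_mSub.1 hZ
    -- Elements of `hSub` have zero first row, so the first row of `[X, Y]` is that of its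
    -- `m`-component `Z`; this row fixes the value of the fundamental field at the base point.
    obtain ⟨β, hβ⟩ := mem_hSub.1 (hk hXYZ)
    have e0 := congrFun (congrFun hβ 0) 0
    have e1 := congrFun (congrFun hβ 0) 1
    rw [subTensor_nabla_killing h]
    simp only [killing_apply, killLin_apply]
    generalize t / -lam = τ at *
    simp [uMat] at e0 e1
    apply Prod.ext <;> simp [uMat, base]
    · linear_combination -e0
    · linear_combination -e1

/-! ### The holonomy algebra and the induced decomposition -/

/-- The generator of the holonomy algebra: the rotation `X₁ ↦ X₂ ↦ -X₁`. -/
def rotEnd : Module.End ℝ (TSpace base) where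
  toFun v := ⟨(0, Complex.I * v.1.2), by
    change bil _ _ = 0
    simp [bil, base]⟩
  map_add' v w := by
    apply Subtype.ext
    apply Prod.ext <;> simp
    ring
  map_smul' c v := by
    apply Subtype.ext
    apply Prod.ext <;> simp
    ring

theorem rotEnd_apply (v : TSpace base) : (rotEnd v).1 = (0, Complex.I * v.1.2) := rfl

theorem commutator_smul_rotEnd (r s : ℝ) :
    (r • rotEnd) * (s • rotEnd) - (s • rotEnd) * (r • rotEnd) = 0 := by
  rw [smul_mul_smul_comm, smul_mul_smul_comm, mul_comm s r]
  exact sub_self ((r * s) • (rotEnd * rotEnd))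

theorem re_fst_eq_zero (v : TSpace base) : v.1.1.re = 0 := by
  have h : bil base.val v.1 = 0 := v.2
  simpa [bil, base] using h

/-- Fields with constant components suffice, so an endomorphism is determined by its values on
vector fields at the base point. -/
theorem exists_at_base (v : TSpace base) : ∃ Z : VF, Z.at base = v := by
  refine ⟨ofComp (cst v.1.1.im) (cst v.1.2.re) (cst v.1.2.im), Subtype.ext ?_⟩
  change (ofComp _ _ _).1 base = v.1
  have := re_fst_eq_zero v
  rw [ofComp_base]
  simp only [cst_apply]
  apply Prod.ext <;> apply Complex.ext <;> simp [this]

theorem at_base_val (X : VF) : (X.at base).1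
    = (Complex.I * (coframe 0 X).1 base, (coframe 1 X).1 base + Complex.I * (coframe 2 X).1 base) := by
  change X.1 base = _
  rw [expand_at X base]
  apply Prod.ext <;> simp [frameAt, base, mul_comm]

/-- `θ¹ ∧ θ²` at the base point. -/
def areaBase (X Y : VF) : ℝ := (coframe 1 X).1 base * (coframe 2 Y).1 base
  - (coframe 2 X).1 base * (coframe 1 Y).1 base

theorem curv_base {lam : ℝ} (h : lam ≠ 0) (t : ℝ) (X Y Z : VF) :
    ((lcConn.subTensor (sLam lam (-lam) (-lam) t)).curv X Y Z).at base
      = ((1 - t / -lam) * 2 * areaBase X Y) • rotEnd (Z.at base) := by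
  apply Subtype.ext
  change ((lcConn.subTensor (sLam lam (-lam) (-lam) t)).curv X Y Z).1 base
    = ((1 - t / -lam) * 2 * areaBase X Y) • (rotEnd (Z.at base)).1
  rw [subTensor_curv h, rotEnd_apply, at_base_val]
  simp only [ofComp_base, ← cst_two, areaBase, Fn.sub_apply, Fn.neg_apply, Fn.mul_apply,
    Fn.zero_apply, cst_apply]
  apply Prod.ext <;> apply Complex.ext <;> simp <;> ring

theorem eq_smul_rotEnd {lam : ℝ} (h : lam ≠ 0) {t : ℝ} {X Y : VF}
    {E : Module.End ℝ (TSpace base)} (hE : ∀ Z : VF, E (Z.at base)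
      = ((lcConn.subTensor (sLam lam (-lam) (-lam) t)).curv X Y Z).at base) :
    E = ((1 - t / -lam) * 2 * areaBase X Y) • rotEnd := by
  ext1 v
  obtain ⟨Z, rfl⟩ := exists_at_base v
  rw [hE, curv_base h]
  rfl

/-- The curvature operators are multiples of `rotEnd` with factor `2 (1 - t / -lam)`, and multiples
commute. The side condition on `r` treats both cases together: a line, or zero when `t = -lam`. -/
theorem mem_holonomy_iff {lam : ℝ} (h : lam ≠ 0) {t : ℝ} {U : Module.End ℝ (TSpace base)} :
    U ∈ holonomy (lcConn.subTensor (sLam lam (-lam) (-lam) t))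
      ↔ ∃ r : ℝ, (t = -lam → r = 0) ∧ U = r • rotEnd := by
  have hτ : t / -lam = 1 ↔ t = -lam := div_eq_one_iff_eq (neg_ne_zero.2 h)
  constructor
  · intro hU
    let L : Submodule ℝ (Module.End ℝ (TSpace base)) :=
      { carrier := {U | ∃ r : ℝ, (t = -lam → r = 0) ∧ U = r • rotEnd}
        add_mem' := by
          rintro _ _ ⟨r, hr, rfl⟩ ⟨s, hs, rfl⟩
          exact ⟨r + s, fun ht => by rw [hr ht, hs ht, add_zero], (add_smul _ _ _).symm⟩
        zero_mem' := ⟨0, fun _ => rfl, (zero_smul _ _).symm⟩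
        smul_mem' := by
          rintro c _ ⟨r, hr, rfl⟩
          exact ⟨c * r, fun ht => by rw [hr ht, mul_zero], smul_smul _ _ _⟩ }
    have hle : holonomy (lcConn.subTensor (sLam lam (-lam) (-lam) t)) ≤ L := by
      refine sInf_le ⟨?_, ?_⟩
      · rintro E ⟨X, Y, hE⟩
        exact ⟨_, fun ht => by rw [hτ.2 ht]; ring, eq_smul_rotEnd h hE⟩
      · rintro _ ⟨r, hr, rfl⟩ _ ⟨s, hs, rfl⟩
        exact ⟨0, fun _ => rfl, (commutator_smul_rotEnd r s).trans (zero_smul _ _).symm⟩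
    exact hle hU
  · rintro ⟨r, hr, rfl⟩
    refine (Submodule.mem_sInf).2 fun L hL => ?_
    by_cases ht : t = -lam
    · rw [hr ht, zero_smul]
      exact L.zero_mem
    · have h1 : (1 - t / -lam) * 2 ≠ 0 :=
        mul_ne_zero (sub_ne_zero.2 fun h2 => ht (hτ.1 h2.symm)) two_ne_zero
      -- The plane spanned by `X₁, X₂` has unit area, so its curvature operator is a nonzero
      -- multiple of the generator.
      have h2 : ((1 - t / -lam) * 2 * areaBase (frame 1) (frame 2)) • rotEnd ∈ L :=
        hL.1 _ ⟨frame 1, frame 2, fun Z => (curv_base h t _ _ Z).symm⟩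
      have h3 : areaBase (frame 1) (frame 2) = 1 := by
        simp [areaBase, coframe_frame, Fn.one_apply, Fn.zero_apply]
      rw [h3, mul_one] at h2
      have h4 := L.smul_mem (r * ((1 - t / -lam) * 2)⁻¹) h2
      rwa [smul_smul, mul_assoc, inv_mul_cancel₀ h1, mul_one] at h4

/-- The isomorphism of the tangent space at the base point onto `m`. -/
def tangentMat (τ : ℝ) : TSpace base →ₗ[ℝ] Mat where
  toFun v := uMat v.1.1.im (-τ * v.1.1.im) v.1.2
  map_add' v w := by
    ext i j
    fin_cases i <;> fin_cases j <;> simp [uMat] <;> ring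
  map_smul' c v := by
    ext i j
    fin_cases i <;> fin_cases j <;> simp [uMat] <;> ring

theorem tangentMat_apply (τ : ℝ) (v : TSpace base) :
    tangentMat τ v = uMat v.1.1.im (-τ * v.1.1.im) v.1.2 := rfl

theorem tangentMat_injective (τ : ℝ) : Function.Injective (tangentMat τ) := by
  intro v w hvw
  obtain ⟨h1, -, h2⟩ := uMat_inj hvw
  refine Subtype.ext (Prod.ext (Complex.ext ?_ h1) h2)
  rw [re_fst_eq_zero, re_fst_eq_zero]

theorem range_tangentMat (lam t : ℝ) :
    LinearMap.range (tangentMat (t / -lam)) = mSub lam t := by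
  ext Y
  rw [mem_mSub, LinearMap.mem_range]
  constructor
  · rintro ⟨v, rfl⟩
    exact ⟨_, _, rfl⟩
  · rintro ⟨α, z, rfl⟩
    refine ⟨⟨(Complex.I * α, z), ?_⟩, ?_⟩
    · change bil _ _ = 0
      simp [bil, base]
    · rw [tangentMat_apply]
      simp

/-- The first vector of the frame at the base point. -/
def vecOne : TSpace base := (frame 1).at base

/-- The map `r • rotEnd ↦ diag(0, -i r)`. -/
def endMat : Module.End ℝ (TSpace base) →ₗ[ℝ] Mat where
  -- At the base point `rotEnd` sends `X₁ = (0, 1)` to `X₂ = (0, i)`, so this imaginary part is the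
  -- coefficient `r`. The sign is forced by `[U, x] = U(x)`.
  toFun U := uMat 0 (-(U vecOne).1.2.im) 0
  map_add' U V := by
    ext i j
    fin_cases i <;> fin_cases j <;> simp [uMat]
    ring
  map_smul' c U := by
    ext i j
    fin_cases i <;> fin_cases j <;> simp [uMat]
    ring

theorem endMat_smul_rotEnd (r : ℝ) : endMat (r • rotEnd) = uMat 0 (-r) 0 := by
  have h : ((r • rotEnd) vecOne).1.2.im = r := by
    change (r • (rotEnd vecOne).1).2.im = r
    rw [rotEnd_apply]
    simp [vecOne, VF.at, frame_apply, frameAt, base]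
  change uMat 0 (-((r • rotEnd) vecOne).1.2.im) 0 = _
  rw [h]

theorem sLam_base {lam : ℝ} (h : lam ≠ 0) (t : ℝ) (X Y : VF) :
    ((sLam lam (-lam) (-lam) t X Y - sLam lam (-lam) (-lam) t Y X).at base).1
      = (Complex.I * (-2 * areaBase X Y : ℝ), (1 + ((t / -lam : ℝ) : ℂ)) * Complex.I
        * ((X.at base).1.1.im * (Y.at base).1.2 - (Y.at base).1.1.im * (X.at base).1.2)) := by
  change (sLam lam (-lam) (-lam) t X Y).1 base - (sLam lam (-lam) (-lam) t Y X).1 base = _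
  rw [sLam_eq h, sLam_eq h, ofComp_base, ofComp_base, at_base_val, at_base_val]
  simp only [areaBase, Fn.sub_apply, Fn.mul_apply, cst_apply]
  generalize t / -lam = τ
  apply Prod.ext <;> apply Complex.ext <;> simp <;> ring

/-- The group enters only through its fundamental fields and `k`, with `hk` saying that `k` has the
size of the holonomy algebra. -/
theorem isInducedDecomposition {G : Subgroup (Matrix.GeneralLinearGroup (Fin 2) ℂ)}
    [MulAction G H31]
    (hfund : ∀ α β z X, IsFundamental G (uMat α β z) X → X = killing α β z)
    {lam : ℝ} (h : lam ≠ 0) (t : ℝ) {k : Submodule ℝ Mat}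
    (hk : ∀ Y, Y ∈ k ↔ ∃ r : ℝ, (t = -lam → r = 0) ∧ Y = uMat 0 r 0) :
    IsInducedDecomposition G k (mSub lam t) lcConn (sLam lam (-lam) (-lam) t) := by
  have hol : ∀ U : holonomy (lcConn.subTensor (sLam lam (-lam) (-lam) t)),
      ∃ r : ℝ, U.1 = r • rotEnd := fun U => by
    obtain ⟨r, -, hr⟩ := (mem_holonomy_iff h).1 U.2
    exact ⟨r, hr⟩
  refine ⟨endMat.domRestrict _, tangentMat (t / -lam), ?_, tangentMat_injective _, ?_,
    range_tangentMat lam t, ?_, ?_, ?_, ?_⟩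
  · intro U V hUV
    obtain ⟨r, hr⟩ := hol U
    obtain ⟨s, hs⟩ := hol V
    change endMat U.1 = endMat V.1 at hUV
    rw [hr, hs, endMat_smul_rotEnd, endMat_smul_rotEnd] at hUV
    have := neg_injective (uMat_inj hUV).2.1
    exact Subtype.ext (by rw [hr, hs, this])
  · ext Y
    rw [hk, LinearMap.mem_range]
    constructor
    · rintro ⟨U, rfl⟩
      obtain ⟨r, h0, hr⟩ := (mem_holonomy_iff h).1 U.2
      refine ⟨-r, fun ht => by rw [h0 ht, neg_zero], ?_⟩
      change endMat U.1 = _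
      rw [hr, endMat_smul_rotEnd]
    · rintro ⟨r, h0, rfl⟩
      refine ⟨⟨(-r) • rotEnd, (mem_holonomy_iff h).2
        ⟨-r, fun ht => by rw [h0 ht, neg_zero], rfl⟩⟩, ?_⟩
      change endMat ((-r) • rotEnd) = _
      rw [endMat_smul_rotEnd, neg_neg]
  · intro x X hX
    rw [tangentMat_apply] at hX
    rw [hfund _ _ _ _ hX]
    apply Subtype.ext
    change (killing _ _ _).1 base = x.1
    have := re_fst_eq_zero x
    apply Prod.ext <;> apply Complex.ext <;> simp [killing_apply, killLin_apply, base, this]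
  · intro U V W hW
    obtain ⟨r, hr⟩ := hol U
    obtain ⟨s, hs⟩ := hol V
    change endMat U.1 * endMat V.1 - endMat V.1 * endMat U.1 = endMat W.1
    rw [hW, hr, hs, commutator_smul_rotEnd, map_zero, endMat_smul_rotEnd, endMat_smul_rotEnd]
    ext i j
    fin_cases i <;> fin_cases j <;> simp [uMat]
    ring
  · intro U x
    obtain ⟨r, hr⟩ := hol U
    change endMat U.1 * _ - _ * endMat U.1 = _
    rw [hr, endMat_smul_rotEnd, LinearMap.smul_apply, map_smul, tangentMat_apply,
      tangentMat_apply, rotEnd_apply]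
    ext i j
    fin_cases i <;> fin_cases j <;> simp [uMat] <;> ring
  -- Let `A` be the area of `X, Y`. The matrix commutator has lower right entry `2iA`: the part
  -- `2iτA` belongs to `m`, and the rest `2i(1 - τ)A` is the curvature term.
  · intro X Y E hE
    change _ = tangentMat _ _ - endMat E.1
    rw [eq_smul_rotEnd h hE, endMat_smul_rotEnd, tangentMat_apply, tangentMat_apply,
      tangentMat_apply, sLam_base h]
    have ha : areaBase X Y = (X.at base).1.2.re * (Y.at base).1.2.im
        - (X.at base).1.2.im * (Y.at base).1.2.re := by
      rw [at_base_val, at_base_val]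
      simp [areaBase]
    rw [ha]
    generalize t / -lam = τ
    generalize (X.at base).1 = v
    generalize (Y.at base).1 = w
    ext i j
    fin_cases i <;> fin_cases j <;> simp [uMat] <;>
      apply Complex.ext <;> simp <;> ring

/-! ### The two induced decompositions and the main theorem -/

theorem U11_isInducedBy {lam t : ℝ} (h : lam < 0) (ht : t ≠ -lam) :
    IsInducedBy U11 hSub (mSub lam t) (kkMetric lam (-lam) (-lam)) lcConn
      (sLam lam (-lam) (-lam) t) (phi0 (-lam) (-lam)) (xi0 lam) (eta0 lam) where
  isometric := isIsometry_of_frameRotation (fun x => ⟨_, _, _, U11_frameRotation x⟩) lam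
  preserves x := (U11_frameRotation x).preservesContact h t
  reductive := U11_isReductiveDecomposition lam t
  canonical := isCanonicalConnection (fun x => ⟨_, _, _, U11_frameRotation x⟩) (by
    rintro Y hY
    obtain ⟨α, β, z, rfl⟩ := mem_lieAlg_U11.1 hY
    rw [isFundamental_U11_iff]
    simp [uMat]) h.ne t le_rfl
  induced := isInducedDecomposition (fun _ _ _ _ => isFundamental_U11_iff.1) h.ne t (fun Y => by
    rw [mem_hSub]
    -- For `t ≠ -lam` the holonomy is a full line, as is `hSub`.
    simp [ht])

theorem SU11_isInducedBy {lam : ℝ} (h : lam < 0) :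
    IsInducedBy SU11 ⊥ su11 (kkMetric lam (-lam) (-lam)) lcConn
      (sLam lam (-lam) (-lam) (-lam)) (phi0 (-lam) (-lam)) (xi0 lam) (eta0 lam) := by
  rw [su11_eq h.ne]
  exact
  { isometric := isIsometry_of_frameRotation (fun x => ⟨_, _, _, SU11_frameRotation x⟩) lam
    preserves := fun x => (SU11_frameRotation x).preservesContact h (-lam)
    reductive := SU11_isReductiveDecomposition h.ne
    canonical := isCanonicalConnection (fun x => ⟨_, _, _, SU11_frameRotation x⟩) (by
      rintro Y hY
      obtain ⟨α, z, rfl⟩ := mem_lieAlg_SU11.1 hY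
      rw [isFundamental_SU11_iff]
      simp [uMat]) h.ne (-lam) bot_le
    induced := isInducedDecomposition (fun _ _ _ _ hX => (isFundamental_SU11_iff.1 hX).2) h.ne
      (-lam) (fun Y => by
        have h0 : uMat 0 0 0 = 0 := by
          ext i j
          fin_cases i <;> fin_cases j <;> simp [uMat]
        simp [h0]) }

end AdS
end

theorem mainTheorem10 (lam mu nu t : ℝ) (hlam : lam < 0) (hmu : -lam = mu) (hnu : mu = nu) :
    AdS.IsLorentzian (AdS.kkMetric lam mu nu) ∧
    (∃! D : AdS.Connection, D.IsLeviCivita (AdS.kkMetric lam mu nu)) ∧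
    ∀ D : AdS.Connection, D.IsLeviCivita (AdS.kkMetric lam mu nu) →
      AdS.IsAlphaSasakian (AdS.cst (1 / Real.sqrt (-lam))) (AdS.kkMetric lam mu nu) D
        (AdS.phi0 mu nu) (AdS.xi0 lam) (AdS.eta0 lam) ∧
      AdS.IsHomogeneousAlmostContact (AdS.kkMetric lam mu nu) D (AdS.sLam lam mu nu t)
        (AdS.phi0 mu nu) (AdS.xi0 lam) (AdS.eta0 lam) ∧
      (t ≠ -lam →
        -- the action of `SU(1,1) × U(1)`
        MulAction.IsPretransitive (AdS.SU11 × Circle) AdS.H31 ∧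
        DiscreteTopology (MulAction.toPermHom (AdS.SU11 × Circle) AdS.H31).ker ∧
        (∀ a : AdS.SU11 × Circle,
          AdS.IsIsometry (AdS.kkMetric lam mu nu) (fun p => a • p)) ∧
        -- it descends to the action of `U(1,1)`
        Function.Surjective AdS.toU11 ∧
        (∀ (a : AdS.SU11 × Circle) (p : AdS.H31), a • p = AdS.toU11 a • p) ∧
        MulAction.IsPretransitive AdS.U11 AdS.H31 ∧
        FaithfulSMul AdS.U11 AdS.H31 ∧
        AdS.IsInducedBy AdS.U11 AdS.hSub (AdS.mSub lam t) (AdS.kkMetric lam mu nu) D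
          (AdS.sLam lam mu nu t) (AdS.phi0 mu nu) (AdS.xi0 lam) (AdS.eta0 lam)) ∧
      (t = -lam →
        MulAction.IsPretransitive AdS.SU11 AdS.H31 ∧
        FaithfulSMul AdS.SU11 AdS.H31 ∧
        AdS.IsInducedBy AdS.SU11 ⊥ AdS.su11 (AdS.kkMetric lam mu nu) D
          (AdS.sLam lam mu nu t) (AdS.phi0 mu nu) (AdS.xi0 lam) (AdS.eta0 lam)) := by
  subst hnu
  subst hmu
  refine ⟨AdS.kkMetric_isLorentzian hlam, ⟨AdS.lcConn, AdS.lcConn_isLeviCivita lam, fun D hD =>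
    AdS.leviCivita_unique hlam.ne hD (AdS.lcConn_isLeviCivita lam)⟩, fun D hD => ?_⟩
  -- Uniqueness reduces every claim to the explicit connection.
  obtain rfl := AdS.leviCivita_unique hlam.ne hD (AdS.lcConn_isLeviCivita lam)
  refine ⟨AdS.isAlphaSasakian hlam, AdS.isHomogeneousAlmostContact hlam t, fun ht => ?_, ?_⟩
  · exact ⟨AdS.SU11xCircle_isPretransitive, AdS.discreteTopology_ker,
      AdS.isIsometry_of_frameRotation AdS.SU11xCircle_frameRotation lam, AdS.toU11_surjective,
      AdS.smul_eq_toU11_smul, AdS.U11_isPretransitive, AdS.U11_faithfulSMul,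
      AdS.U11_isInducedBy hlam ht⟩
  · rintro rfl
    exact ⟨AdS.SU11_isPretransitive, AdS.SU11_faithfulSMul, AdS.SU11_isInducedBy hlam⟩
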